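/- For each $n\ge 1$ let $Y_i=\mu_i+\varepsilon_i$, $i=1,\dots,n$, where $\mu_1,\dots,\mu_n$ are arbitrary real random variables and $\varepsilon_1,\dots,\varepsilon_n$ are i.i.d. $N(0,1)$, independent of $(\mu_1,\dots,\mu_n)$ (all objects may depend on $n$). Let $\tilde\mu_i$ and $\hat\mu_i$ be measurable functions of the data $Y_1,\dots,Y_n$ and put $Z_i=Y_i-\tilde\mu_i$, $\nu_i=\mu_i-\tilde\mu_i$. Assume: 1. $\tilde\mu_i$ is a function of $(Y_j)_{j\ne i}$ only, and for $j\neq i$ replacing $Y_j$ by $Y_j+d$ changes $\tilde\mu_i$ by at most $\rho_{|i-j|}|d|$, where $(\rho_M)$ is a sequence not depending on $n$ with $\limsup_{M\to\infty}M^2\rho_M<1$. 2. There is a random variable $\alpha_n$, a measurable function of $(Y_j)_{j\neq n}$, with $0<\alpha_n<1$ almost surely, such that $\hat\mu_i=\alpha_n\tilde\mu_i+(1-\alpha_n)Y_i+\zeta_i$, where $E\zeta_i^2\to0$ as $n\to\infty$, $0<\liminf i/n\le\limsup i/n<1$; that is, for every $c>0$, $\sup\{E\zeta_i^2:\ cn\le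 i\le(1-c)n\}\to0$ as $n\to\infty$. 3. For all sufficiently large $n$, $\frac1n\sum_{i=1}^nP(|Y_i-\tilde\mu_i|>\log n)\le(\log n)^{-8}$. Let $\varphi$ be the standard normal density, $f_Z(z)=\frac1n\sum_{i=1}^n\varphi(z-\nu_i)$, $\delta^n(z)=z+f_Z'(z)/f_Z(z)$, and let $\mu^I_i=\tilde\mu_i+\delta^n(Z_i)$ be the oracle improved estimator. Let $F^n_\nu=\frac1n\sum_{i=1}^n\delta_{\nu_i}$ be the (random) empirical distribution of $\nu_1,\dots,\nu_n$. If $n^{-1}E\sum_{i=1}^n(\mu^I_i-\hat\mu_i)^2\to0$, then the random signed measures $F^n_\nu-N\bigl(0,(1-\alpha_n)/\alpha_n\bigr)$ converge to the zero measure, in the following sense. (a) If $\alpha_n$ is bounded away from $0$ in probability (for every $e>0$ there is $c>0$ with $P(\alpha_n<c)\le e$ for all large $n$), the convergence is weak, in probability: for every bounded continuous $g:\mathbb R\to\mathbb R$, $$\int g\,dF^n_\nu-\int g\,dN\bigl(0,(1-\alpha_n)/\alpha_n\bigr)\to0\quad\text{in probability.}$$ (b) With no condition on $\alpha_n$ beyond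 2, the same holds for every continuous $g:\mathbb R\to\mathbb R$ with $g(x)\to 0$ as $|x|\to\infty$. -/

import Mathlib

open MeasureTheory ProbabilityTheory Filter Topology
open scoped ENNReal NNReal

noncomputable section

namespace KalmanEB

/-- The observation model at sample size `n`: the noises `ε 1, …, ε n` are i.i.d. `N(0,1)` and
independent of the (arbitrary) random signal `(μ 1, …, μ n)`. -/
structure IsSignalPlusNoise {Ω : Type*} [MeasurableSpace Ω] (P : Measure Ω) {n : ℕ}
    (μ ε : Fin n → Ω → ℝ) : Prop where
  measurable_signal : ∀ i, Measurable (μ i)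
  measurable_noise : ∀ i, Measurable (ε i)
  noise_gaussian : ∀ i, P.map (ε i) = gaussianReal 0 1
  noise_indep : iIndepFun ε P
  indep : IndepFun (fun ω i => μ i ω) (fun ω i => ε i ω) P

/-- The data vector `Y = μ + ε`. -/
def obs {Ω : Type*} {n : ℕ} (μ ε : Fin n → Ω → ℝ) (ω : Ω) : Fin n → ℝ :=
  fun i => μ i ω + ε i ω

/-- The residuals `Z i = Y i - μ̃ i`, where `mt i` computes `μ̃ i` from the data. -/
def resid {Ω : Type*} {n : ℕ} (μ ε : Fin n → Ω → ℝ) (mt : Fin n → (Fin n → ℝ) → ℝ) (ω : Ω) :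
    Fin n → ℝ :=
  fun i => obs μ ε ω i - mt i (obs μ ε ω)

/-- The centred signal `ν i = μ i - μ̃ i`. -/
def centred {Ω : Type*} {n : ℕ} (μ ε : Fin n → Ω → ℝ) (mt : Fin n → (Fin n → ℝ) → ℝ) (ω : Ω) :
    Fin n → ℝ :=
  fun i => μ i ω - mt i (obs μ ε ω)

/-- The mixture density `f_Z(z) = n⁻¹ ∑ᵢ φ(z - νᵢ)`, `φ` the standard normal density. -/
def mixDensity {n : ℕ} (v : Fin n → ℝ) (z : ℝ) : ℝ :=
  (n : ℝ)⁻¹ * ∑ i, gaussianPDFReal 0 1 (z - v i)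

/-- The oracle decision function `δⁿ(z) = z + f_Z'(z) / f_Z(z)`. -/
def oracle {n : ℕ} (v : Fin n → ℝ) (z : ℝ) : ℝ :=
  z + deriv (mixDensity v) z / mixDensity v z

/-- The oracle improved estimator `μᴵ i = μ̃ i + δⁿ(Z i)`; `δⁿ` is the random function built from
the realized `ν 1, …, ν n`. -/
def improved {Ω : Type*} {n : ℕ} (μ ε : Fin n → Ω → ℝ) (mt : Fin n → (Fin n → ℝ) → ℝ) (ω : Ω) :
    Fin n → ℝ :=
  fun i => mt i (obs μ ε ω) + oracle (centred μ ε mt ω) (resid μ ε mt ω i)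

/-- The empirical distribution of the points `v 1, …, v n`. -/
def empirical {n : ℕ} (v : Fin n → ℝ) : Measure ℝ :=
  (n : ℝ≥0∞)⁻¹ • ∑ i, Measure.dirac (v i)

/-- Each `μ̃ i` is a measurable function of the observations `Y j`, `j ≠ i`, and is Lipschitz in
`Y j` with a constant `ρ |i - j|`, where `limsup M² ρ M < 1`. -/
structure IsLocalPredictor (mt : ∀ n, Fin n → (Fin n → ℝ) → ℝ) (ρ : ℕ → ℝ) : Prop where
  measurable : ∀ n i, Measurable (mt n i)
  dependsOn : ∀ n i, DependsOn (mt n i) {j | j ≠ i}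
  lipschitz : ∀ (n : ℕ) (i j : Fin n), j ≠ i → ∀ (y : Fin n → ℝ) (d : ℝ),
    |mt n i (Function.update y j (y j + d)) - mt n i y| ≤ ρ (Nat.dist i j) * |d|
  limsup_lt : limsup (fun M : ℕ => (((M : ℝ) ^ 2 * ρ M : ℝ) : EReal)) atTop < 1

/-- `μ̂ i = α μ̃ i + (1 - α) Y i + ζ i` with `α = α n` a function of `Y j`, `j ≠ n`, with values in
`(0,1)`, and `E ζ i ² → 0` as `n → ∞`, uniformly in `c n ≤ i ≤ (1 - c) n`, for every `c > 0`.
(The index `i : Fin n` stands for the time `i + 1`.) -/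
structure IsAsymptoticAverage {Ω : ℕ → Type*} [∀ n, MeasurableSpace (Ω n)]
    (P : ∀ n, Measure (Ω n)) (μ ε : ∀ n, Fin n → Ω n → ℝ)
    (mt mh : ∀ n, Fin n → (Fin n → ℝ) → ℝ) (α : ∀ n, (Fin n → ℝ) → ℝ) : Prop where
  measurable : ∀ n, Measurable (α n)
  dependsOn : ∀ n, DependsOn (α n) {j | (j : ℕ) + 1 ≠ n}
  mem_Ioo : ∀ n, ∀ᵐ ω ∂P n, α n (obs (μ n) (ε n) ω) ∈ Set.Ioo (0 : ℝ) 1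
  remainder : ∀ c : ℝ, 0 < c →
    Tendsto (fun n : ℕ => ⨆ (i : Fin n)
        (_ : c * (n : ℝ) ≤ ((i : ℕ) : ℝ) + 1 ∧ ((i : ℕ) : ℝ) + 1 ≤ (1 - c) * (n : ℝ)),
        ∫⁻ ω, ENNReal.ofReal
          ((mh n i (obs (μ n) (ε n) ω)
            - (α n (obs (μ n) (ε n) ω) * mt n i (obs (μ n) (ε n) ω)
              + (1 - α n (obs (μ n) (ε n) ω)) * obs (μ n) (ε n) ω i)) ^ 2) ∂P n)
      atTop (𝓝 0)

/-- For all large `n`, `n⁻¹ ∑ᵢ P(|Y i - μ̃ i| > log n) ≤ (log n)⁻⁸`. -/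
def HasLogTails {Ω : ℕ → Type*} [∀ n, MeasurableSpace (Ω n)]
    (P : ∀ n, Measure (Ω n)) (μ ε : ∀ n, Fin n → Ω n → ℝ)
    (mt : ∀ n, Fin n → (Fin n → ℝ) → ℝ) : Prop :=
  ∀ᶠ n : ℕ in atTop,
    (1 / (n : ℝ)) * ∑ i, (P n).real {ω | Real.log n < |resid (μ n) (ε n) (mt n) ω i|}
      ≤ 1 / (Real.log n) ^ 8

/-- Integral of `g` against the random signed measure `F_νⁿ - N(0, (1 - αₙ)/αₙ)`. -/
def discrepancy {Ω : Type*} {n : ℕ} (μ ε : Fin n → Ω → ℝ) (mt : Fin n → (Fin n → ℝ) → ℝ)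
    (α : (Fin n → ℝ) → ℝ) (g : ℝ → ℝ) (ω : Ω) : ℝ :=
  (∫ x, g x ∂(empirical (centred μ ε mt ω)))
    - ∫ x, g x ∂(gaussianReal 0
        (Real.toNNReal ((1 - α (obs μ ε ω)) / α (obs μ ε ω))))

/-- Convergence to `0` in probability of random variables living on varying probability spaces. -/
def TendstoZeroInProb {Ω : ℕ → Type*} [∀ n, MeasurableSpace (Ω n)]
    (P : ∀ n, Measure (Ω n)) (X : ∀ n, Ω n → ℝ) : Prop :=
  ∀ e : ℝ, 0 < e → Tendsto (fun n => P n {ω | e ≤ |X n ω|}) atTop (𝓝 0)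

/-- The variables `A n` are bounded away from `0` in probability. -/
def BoundedBelowInProb {Ω : ℕ → Type*} [∀ n, MeasurableSpace (Ω n)]
    (P : ∀ n, Measure (Ω n)) (A : ∀ n, Ω n → ℝ) : Prop :=
  ∀ e : ℝ, 0 < e → ∃ c : ℝ, 0 < c ∧ ∀ᶠ n in atTop, (P n).real {ω | A n ω < c} ≤ e

end KalmanEB

end

/-! Write `f` for the mixture density of the `ν i` with standard normal noise. By the definition of
the oracle, the improved estimator minus `α μ̃ i + (1 - α) Y i` equals `f'/f + α z` at `z = Z i`
(`score_eq`). The hypothesis therefore says that `f'/f + α z` is small in mean square over the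
residuals, at least for the middle indices, where `ζ i` is controlled. The identity `f'/f = -α z`
characterises the `N(0, 1/α)` density, and removing the unit noise leaves `N(0, 1/α - 1)` for the `ν
i`. The proof makes this stable in two steps.

Deterministic step (`exists_abs_gap_lt`). Suppose `f' + a z f` is small in `L¹` on bounded
intervals. The integrating factor `exp (a z²/2)` shows that `f` is close to `f 0 * exp (-a z²/2)`.
Along a subsequence, `a → a₀` and `f 0 → c`. If `a₀ > 0`, the inequality `a |z| f ≤ |f' + a z f| +
|f'|` and the bound `∫ |f'| ≤ 1` give tightness, so `f` converges in `L¹` to the `N(0, 1/a₀)`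
density; dividing characteristic functions by that of the noise gives the limit of the mixing laws.
If `a₀ = 0`, then `f` tends to a constant, which is `0` because the mass is at most `1`. Both the
empirical law and the normal law then escape to infinity, and a test function vanishing at infinity
cannot separate them.

Probabilistic step. The average of a fixed function over the residuals must be replaced by its
integral against the mixture. Given the signal and the other noises, `Z i` has law `N(ν i, 1)`, and
the summable Lipschitz constants `ρ` make the centred terms weakly correlated, so the variance of
the average is `O(1/n)` (`integral_sq_sum_fluct_le`). The score itself depends on the random `ν i`,
so a bound uniform over test functions is needed. The score is truncated to be bounded and
Lipschitz, then mollified, and the comparison reduces to the `L¹` distance between a kernel density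
estimate and its conditional mean (`abs_average_sub_integral_le`). Cutoff `log n`, floor `(log n)⁻⁴`
and bandwidth `(log n)⁻¹⁰` make all errors vanish. Markov's inequality and a union bound conclude.
-/

namespace KalmanEB

local notation "φ" => gaussianPDFReal 0 1
local notation "γ" => gaussianReal 0 1

/-! ### The standard normal density -/

lemma stdPDF_eq (x : ℝ) : φ x = (√(2 * Real.pi))⁻¹ * Real.exp (-x ^ 2 / 2) := by
  simp [gaussianPDFReal]

lemma stdPDF_pos (x : ℝ) : 0 < φ x := gaussianPDFReal_pos 0 1 x one_ne_zero

lemma stdPDF_nonneg (x : ℝ) : 0 ≤ φ x := (stdPDF_pos x).le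

lemma stdPDF_neg (x : ℝ) : φ (-x) = φ x := by simp [stdPDF_eq]

lemma inv_sqrt_two_pi_le : (√(2 * Real.pi))⁻¹ ≤ 1 / 2 := by
  have h : (2 : ℝ) ≤ √(2 * Real.pi) := by
    apply Real.le_sqrt_of_sq_le
    nlinarith [Real.pi_gt_three]
  rw [inv_eq_one_div]
  exact one_div_le_one_div_of_le two_pos h

lemma stdPDF_le_one (x : ℝ) : φ x ≤ 1 := by
  rw [stdPDF_eq]
  have h1 : Real.exp (-x ^ 2 / 2) ≤ 1 := Real.exp_le_one_iff.2 (by nlinarith [sq_nonneg x])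
  have h2 := inv_sqrt_two_pi_le
  have h3 : 0 ≤ (√(2 * Real.pi))⁻¹ := by positivity
  nlinarith [Real.exp_pos (-x ^ 2 / 2)]

lemma sq_mul_stdPDF_le_one (x : ℝ) : x ^ 2 * φ x ≤ 1 := by
  rw [stdPDF_eq]
  have h1 : x ^ 2 / 2 * Real.exp (-x ^ 2 / 2) ≤ 1 := by
    have h := Real.add_one_le_exp (x ^ 2 / 2)
    have h' : Real.exp (x ^ 2 / 2) * Real.exp (-x ^ 2 / 2) = 1 := by
      rw [← Real.exp_add]; simp [neg_div]
    nlinarith [Real.exp_pos (-x ^ 2 / 2)]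
  have h2 := inv_sqrt_two_pi_le
  have h3 : 0 ≤ (√(2 * Real.pi))⁻¹ := by positivity
  have h4 : 0 ≤ x ^ 2 / 2 * Real.exp (-x ^ 2 / 2) := by positivity
  nlinarith

lemma abs_mul_stdPDF_le_one (x : ℝ) : |x| * φ x ≤ 1 := by
  have h1 := sq_mul_stdPDF_le_one x
  have h2 := stdPDF_le_one x
  have h3 : |x| ≤ (x ^ 2 + 1) / 2 := by
    rw [← sq_abs]; nlinarith [sq_nonneg (|x| - 1)]
  nlinarith [stdPDF_nonneg x]

lemma hasDerivAt_stdPDF (x : ℝ) : HasDerivAt φ (-(x * φ x)) x := by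
  have h : HasDerivAt (fun x : ℝ => (√(2 * Real.pi))⁻¹ * Real.exp (-x ^ 2 / 2))
      ((√(2 * Real.pi))⁻¹ * (Real.exp (-x ^ 2 / 2) * (-(2 * x) / 2))) x := by
    have := (((hasDerivAt_pow 2 x).neg.div_const 2).exp).const_mul (√(2 * Real.pi))⁻¹
    convert! this using 1
    simp
  have he : φ = fun x : ℝ => (√(2 * Real.pi))⁻¹ * Real.exp (-x ^ 2 / 2) := funext stdPDF_eq
  rw [he]
  convert h using 1
  ring

lemma continuous_stdPDF : Continuous φ :=
  continuous_iff_continuousAt.2 fun x => (hasDerivAt_stdPDF x).continuousAt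

lemma hasDerivAt_mul_stdPDF (x : ℝ) : HasDerivAt (fun x => x * φ x) ((1 - x ^ 2) * φ x) x := by
  have := (hasDerivAt_id x).mul (hasDerivAt_stdPDF x)
  convert! this using 1
  simp only [id]; ring

lemma abs_stdPDF_sub_le (x y : ℝ) : |φ x - φ y| ≤ |x - y| := by
  have h := Convex.norm_image_sub_le_of_norm_hasDerivWithin_le (f := φ)
    (f' := fun x => -(x * φ x)) (s := Set.univ) (C := 1) (x := y) (y := x)
    (fun x _ => (hasDerivAt_stdPDF x).hasDerivWithinAt)
    (fun x _ => by
      rw [norm_neg, Real.norm_eq_abs, abs_mul, abs_of_nonneg (stdPDF_nonneg x)]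
      exact abs_mul_stdPDF_le_one x) convex_univ trivial trivial
  simpa using h

lemma abs_mul_stdPDF_sub_le (x y : ℝ) : |x * φ x - y * φ y| ≤ |x - y| := by
  have h := Convex.norm_image_sub_le_of_norm_hasDerivWithin_le (f := fun x => x * φ x)
    (f' := fun x => (1 - x ^ 2) * φ x) (s := Set.univ) (C := 1) (x := y) (y := x)
    (fun x _ => (hasDerivAt_mul_stdPDF x).hasDerivWithinAt)
    (fun x _ => by
      rw [Real.norm_eq_abs, abs_le]
      constructor <;>
      nlinarith [stdPDF_nonneg x, stdPDF_le_one x, sq_mul_stdPDF_le_one x,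
        mul_nonneg (sq_nonneg x) (stdPDF_nonneg x)]) convex_univ trivial trivial
  simpa using h

lemma integrable_stdPDF : Integrable φ := integrable_gaussianPDFReal 0 1

lemma integral_stdPDF : ∫ x, φ x = 1 := integral_gaussianPDFReal_eq_one 0 one_ne_zero

lemma integral_stdGaussian (w : ℝ → ℝ) : ∫ x, w x ∂γ = ∫ x, φ x * w x := by
  rw [integral_gaussianReal_eq_integral_smul one_ne_zero]; rfl

lemma integrable_stdGaussian_iff {w : ℝ → ℝ} :
    Integrable w γ ↔ Integrable (fun x => φ x * w x) := by
  rw [gaussianReal_of_var_ne_zero 0 one_ne_zero,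
    integrable_withDensity_iff_integrable_smul' (measurable_gaussianPDF 0 1)
      (by simp [gaussianPDF])]
  simp only [toReal_gaussianPDF, smul_eq_mul]

lemma integrable_sq_stdGaussian : Integrable (fun x : ℝ => x ^ 2) γ := by
  have : MemLp (fun x : ℝ => x) 2 γ := by
    exact_mod_cast memLp_id_gaussianReal (μ := 0) (v := 1) 2
  exact (memLp_two_iff_integrable_sq (by fun_prop)).1 this

lemma integral_sq_stdGaussian : ∫ x : ℝ, x ^ 2 ∂γ = 1 := by
  have h := variance_fun_id_gaussianReal (μ := 0) (v := 1)
  rw [variance_eq_integral (by fun_prop)] at h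
  simpa using h

lemma integrable_abs_stdGaussian : Integrable (fun x : ℝ => |x|) γ := by
  have h := (integrable_sq_stdGaussian.add (integrable_const 1))
  refine h.mono (by fun_prop) (ae_of_all _ fun x => ?_)
  simp only [Pi.add_apply, Real.norm_eq_abs, abs_abs]
  rw [abs_of_nonneg (by positivity : 0 ≤ x ^ 2 + 1), ← sq_abs]
  nlinarith [sq_nonneg (|x| - 1)]

lemma integral_abs_stdGaussian_le : ∫ x : ℝ, |x| ∂γ ≤ 1 := by
  have h : ∫ x : ℝ, |x| ∂γ ≤ ∫ x : ℝ, (x ^ 2 + 1) / 2 ∂γ := by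
    refine integral_mono integrable_abs_stdGaussian
      ((integrable_sq_stdGaussian.add (integrable_const 1)).div_const 2) fun x => ?_
    beta_reduce
    rw [← sq_abs]; nlinarith [sq_nonneg (|x| - 1)]
  refine h.trans ?_
  rw [integral_div, integral_add integrable_sq_stdGaussian (integrable_const 1),
    integral_sq_stdGaussian]
  simp

lemma integrable_abs_mul_stdPDF : Integrable fun x : ℝ => |x| * φ x := by
  have := integrable_stdGaussian_iff.1 integrable_abs_stdGaussian
  simpa only [mul_comm] using this

lemma integral_abs_mul_stdPDF_le : ∫ x : ℝ, |x| * φ x ≤ 1 := by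
  have := integral_abs_stdGaussian_le
  rw [integral_stdGaussian] at this
  simpa only [mul_comm] using this

/-! ### Normal mixtures -/

/-- The part of the mixture density carried by the components in `S`. -/
noncomputable def mixOn {n : ℕ} (S : Finset (Fin n)) (v : Fin n → ℝ) (z : ℝ) : ℝ :=
  (n : ℝ)⁻¹ * ∑ i ∈ S, φ (z - v i)

/-- The derivative of the mixture density. -/
noncomputable def mixSlope {n : ℕ} (v : Fin n → ℝ) (z : ℝ) : ℝ :=
  (n : ℝ)⁻¹ * ∑ i, -((z - v i) * φ (z - v i))

section Mixture

variable {n : ℕ} (S : Finset (Fin n)) (v : Fin n → ℝ)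

lemma mixOn_univ : mixOn Finset.univ v = mixDensity v := rfl

lemma hasDerivAt_mixDensity (z : ℝ) : HasDerivAt (mixDensity v) (mixSlope v z) z := by
  refine HasDerivAt.const_mul _ (HasDerivAt.fun_sum fun i _ => ?_)
  have := (hasDerivAt_stdPDF (z - v i)).comp z ((hasDerivAt_id z).sub_const (v i))
  convert! this using 1
  simp

lemma oracle_eq (z : ℝ) : oracle v z = z + mixSlope v z / mixDensity v z := by
  rw [oracle, (hasDerivAt_mixDensity v z).deriv]

lemma continuous_mixOn : Continuous (mixOn S v) := by
  unfold mixOn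
  have := continuous_stdPDF
  fun_prop

lemma continuous_mixDensity : Continuous (mixDensity v) := continuous_mixOn Finset.univ v

lemma continuous_mixSlope : Continuous (mixSlope v) := by
  unfold mixSlope
  have := continuous_stdPDF
  fun_prop

lemma mixOn_nonneg (z : ℝ) : 0 ≤ mixOn S v z :=
  mul_nonneg (by positivity) (Finset.sum_nonneg fun _ _ => stdPDF_nonneg _)

lemma mixOn_le_mixDensity (z : ℝ) : mixOn S v z ≤ mixDensity v z :=
  mul_le_mul_of_nonneg_left (Finset.sum_le_sum_of_subset_of_nonneg (Finset.subset_univ S)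
    fun _ _ _ => stdPDF_nonneg _) (by positivity)

lemma mixDensity_nonneg (z : ℝ) : 0 ≤ mixDensity v z := mixOn_nonneg Finset.univ v z

lemma mixDensity_pos (hn : 0 < n) (z : ℝ) : 0 < mixDensity v z := by
  have : Nonempty (Fin n) := ⟨⟨0, hn⟩⟩
  exact mul_pos (by positivity) (Finset.sum_pos (fun _ _ => stdPDF_pos _) Finset.univ_nonempty)

/-- Averages of `n` numbers of modulus at most `C` have modulus at most `C`. -/
lemma abs_average_le {C : ℝ} (hC : 0 ≤ C) {x : Fin n → ℝ} (hx : ∀ i ∈ S, |x i| ≤ C) :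
    |(n : ℝ)⁻¹ * ∑ i ∈ S, x i| ≤ C := by
  rw [abs_mul, abs_of_nonneg (by positivity : 0 ≤ (n : ℝ)⁻¹)]
  have h1 : |∑ i ∈ S, x i| ≤ S.card * C :=
    (Finset.abs_sum_le_sum_abs _ _).trans ((Finset.sum_le_card_nsmul _ _ _ hx).trans
      (by rw [nsmul_eq_mul]))
  have h2 : (S.card : ℝ) ≤ n := by
    exact_mod_cast (Finset.card_le_univ S).trans_eq (Fintype.card_fin n)
  rcases Nat.eq_zero_or_pos n with h0 | h0
  · subst h0; simpa using hC
  · have h0' : (0 : ℝ) < n := by exact_mod_cast h0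
    calc (n : ℝ)⁻¹ * |∑ i ∈ S, x i| ≤ (n : ℝ)⁻¹ * (n * C) := by
          gcongr; exact h1.trans (by gcongr)
      _ = C := by field_simp

lemma mixOn_le_one (z : ℝ) : mixOn S v z ≤ 1 :=
  (le_abs_self _).trans (abs_average_le S zero_le_one fun i _ => by
    rw [abs_of_nonneg (stdPDF_nonneg _)]; exact stdPDF_le_one _)

lemma mixDensity_le_one (z : ℝ) : mixDensity v z ≤ 1 := mixOn_le_one Finset.univ v z

lemma abs_mixSlope_le_one (z : ℝ) : |mixSlope v z| ≤ 1 :=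
  abs_average_le _ zero_le_one fun i _ => by
    rw [abs_neg, abs_mul, abs_of_nonneg (stdPDF_nonneg _)]; exact abs_mul_stdPDF_le_one _

lemma abs_mixDensity_sub_le (x y : ℝ) : |mixDensity v x - mixDensity v y| ≤ |x - y| := by
  rw [mixDensity, mixDensity, ← mul_sub, ← Finset.sum_sub_distrib]
  refine abs_average_le _ (abs_nonneg _) fun i _ => ?_
  simpa using abs_stdPDF_sub_le (x - v i) (y - v i)

lemma abs_mixSlope_sub_le (x y : ℝ) : |mixSlope v x - mixSlope v y| ≤ |x - y| := by
  rw [mixSlope, mixSlope, ← mul_sub, ← Finset.sum_sub_distrib]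
  refine abs_average_le _ (abs_nonneg _) fun i _ => ?_
  have := abs_mul_stdPDF_sub_le (x - v i) (y - v i)
  rw [neg_sub_neg, abs_sub_comm]
  simpa using this

/-- Cauchy–Schwarz with weights `φ (z - v i)`, the remaining factor being an average of `x² φ x ≤
1`. It makes the slope negligible wherever the density is small, so that the floor `η` costs little.
-/
lemma sq_mixSlope_le (z : ℝ) : mixSlope v z ^ 2 ≤ mixDensity v z := by
  have h := Finset.sum_sq_le_sum_mul_sum_of_sq_le_mul (Finset.univ : Finset (Fin n))
    (r := fun i => -((z - v i) * φ (z - v i))) (f := fun i => φ (z - v i))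
    (g := fun i => (z - v i) ^ 2 * φ (z - v i)) (fun i _ => stdPDF_nonneg _)
    (fun i _ => mul_nonneg (sq_nonneg _) (stdPDF_nonneg _)) (fun i _ => by apply le_of_eq; ring)
  have h2 : |(n : ℝ)⁻¹ * ∑ i, (z - v i) ^ 2 * φ (z - v i)| ≤ 1 :=
    abs_average_le _ zero_le_one fun i _ => by
      rw [abs_of_nonneg (mul_nonneg (sq_nonneg _) (stdPDF_nonneg _))]
      exact sq_mul_stdPDF_le_one _
  have h3 : mixSlope v z ^ 2
      ≤ mixDensity v z * ((n : ℝ)⁻¹ * ∑ i, (z - v i) ^ 2 * φ (z - v i)) := by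
    rw [mixSlope, mixDensity, mul_pow]
    calc _ ≤ ((n : ℝ)⁻¹) ^ 2 * ((∑ i, φ (z - v i)) * ∑ i, (z - v i) ^ 2 * φ (z - v i)) := by
          gcongr
      _ = _ := by ring
  exact h3.trans (mul_le_of_le_one_right (mixDensity_nonneg v z) ((le_abs_self _).trans h2))

lemma abs_mixSlope_le_sqrt (z : ℝ) : |mixSlope v z| ≤ √(mixDensity v z) :=
  Real.abs_le_sqrt (sq_mixSlope_le v z)

lemma mixDensity_sub_mixOn (z : ℝ) : mixDensity v z - mixOn S v z = mixOn Sᶜ v z := by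
  rw [mixDensity, mixOn, mixOn, ← Finset.sum_add_sum_compl S]; ring

lemma mixOn_le_card (z : ℝ) : mixOn S v z ≤ S.card / n := by
  rw [mixOn, div_eq_inv_mul]
  gcongr
  refine (Finset.sum_le_card_nsmul _ _ 1 fun i _ => stdPDF_le_one _).trans (by simp)

lemma integrable_mixOn : Integrable (mixOn S v) :=
  (integrable_finsetSum _ fun i _ => integrable_stdPDF.comp_sub_right (v i)).const_mul _

lemma integrable_mixDensity : Integrable (mixDensity v) := integrable_mixOn Finset.univ v

lemma integral_mixOn : ∫ z, mixOn S v z = S.card / n := by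
  unfold mixOn
  rw [integral_const_mul,
    integral_finsetSum _ fun i _ => integrable_stdPDF.comp_sub_right (v i)]
  simp_rw [integral_sub_right_eq_self φ, integral_stdPDF]
  simp [div_eq_inv_mul]

lemma integral_mixDensity (hn : 0 < n) : ∫ z, mixDensity v z = 1 := by
  rw [← mixOn_univ, integral_mixOn]
  simp [hn.ne']

lemma integrable_mixSlope_bound : Integrable fun z =>
    (n : ℝ)⁻¹ * ∑ i, |z - v i| * φ (z - v i) :=
  (integrable_finsetSum _ fun i _ => integrable_abs_mul_stdPDF.comp_sub_right (v i)).const_mul _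

lemma abs_mixSlope_le_bound (z : ℝ) :
    |mixSlope v z| ≤ (n : ℝ)⁻¹ * ∑ i, |z - v i| * φ (z - v i) := by
  rw [mixSlope, abs_mul, abs_of_nonneg (by positivity : 0 ≤ (n : ℝ)⁻¹)]
  gcongr
  refine (Finset.abs_sum_le_sum_abs _ _).trans_eq (Finset.sum_congr rfl fun i _ => ?_)
  rw [abs_neg, abs_mul, abs_of_nonneg (stdPDF_nonneg _)]

lemma integrable_abs_mixSlope : Integrable fun z => |mixSlope v z| :=
  (integrable_mixSlope_bound v).mono' (continuous_mixSlope v).abs.aestronglyMeasurable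
    (ae_of_all _ fun z => by simpa using abs_mixSlope_le_bound v z)

lemma integral_abs_mixSlope_le : ∫ z, |mixSlope v z| ≤ 1 := by
  refine (integral_mono (integrable_abs_mixSlope v) (integrable_mixSlope_bound v)
    (abs_mixSlope_le_bound v)).trans ?_
  rw [integral_const_mul,
    integral_finsetSum _ fun i _ => integrable_abs_mul_stdPDF.comp_sub_right (v i)]
  refine (le_abs_self _).trans (abs_average_le _ zero_le_one fun i _ => ?_)
  rw [integral_sub_right_eq_self (fun x => |x| * φ x),
    abs_of_nonneg (integral_nonneg fun x => mul_nonneg (abs_nonneg _) (stdPDF_nonneg _))]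
  exact integral_abs_mul_stdPDF_le

end Mixture

/-! ### The truncated score -/

/-- A continuous cutoff, equal to `1` on `[-K, K]` and to `0` outside `[-K - 1, K + 1]`. -/
noncomputable def cutoff (K z : ℝ) : ℝ := max 0 (min 1 (K + 1 - |z|))

lemma cutoff_nonneg (K z : ℝ) : 0 ≤ cutoff K z := le_max_left _ _

lemma cutoff_le_one (K z : ℝ) : cutoff K z ≤ 1 := max_le zero_le_one (min_le_left _ _)

lemma cutoff_eq_one {K z : ℝ} (h : |z| ≤ K) : cutoff K z = 1 := by
  rw [cutoff, min_eq_left (by linarith), max_eq_right zero_le_one]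

lemma cutoff_eq_zero {K z : ℝ} (h : K + 1 ≤ |z|) : cutoff K z = 0 := by
  rw [cutoff, max_eq_left]
  exact (min_le_right _ _).trans (by linarith)

lemma continuous_cutoff (K : ℝ) : Continuous (cutoff K) := by unfold cutoff; fun_prop

/-- The modulus of `f' / f + a z`, for `f` the mixture density, with the denominator kept above `η`
and cut off outside `[-K, K]`. -/
noncomputable def truncScore {n : ℕ} (v : Fin n → ℝ) (a η K z : ℝ) : ℝ :=
  |mixSlope v z + a * z * mixDensity v z| / max (mixDensity v z) η * cutoff K z

section Static

variable {n : ℕ} (S : Finset (Fin n)) (v : Fin n → ℝ) {a η K : ℝ}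

lemma truncScore_nonneg (hη : 0 < η) (z : ℝ) : 0 ≤ truncScore v a η K z :=
  mul_nonneg (div_nonneg (abs_nonneg _) (hη.le.trans (le_max_right _ _))) (cutoff_nonneg _ _)

lemma continuous_truncScore (hη : 0 < η) : Continuous (truncScore v a η K) := by
  unfold truncScore
  have h1 := continuous_mixDensity v
  have h2 := continuous_mixSlope v
  have h3 := continuous_cutoff K
  refine Continuous.mul (Continuous.div (by fun_prop) (by fun_prop) fun z => ?_) h3
  exact (hη.trans_le (le_max_right _ _)).ne'

lemma hasCompactSupport_truncScore : HasCompactSupport (truncScore v a η K) :=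
  HasCompactSupport.intro (isCompact_Icc (a := -(K + 1)) (b := K + 1)) fun z hz => by
    rw [truncScore, cutoff_eq_zero, mul_zero]
    by_contra h
    exact hz (abs_le.1 (not_le.1 h).le)

lemma integrable_truncScore_mul (hη : 0 < η) :
    Integrable fun z => truncScore v a η K z * mixOn S v z :=
  ((continuous_truncScore v hη).mul (continuous_mixOn S v)).integrable_of_hasCompactSupport
    (hasCompactSupport_truncScore v).mul_right

lemma mixDensity_sub_mixOn_le (z : ℝ) :
    mixDensity v z - mixOn S v z ≤ (Sᶜ.card : ℝ) / n := by
  rw [mixDensity_sub_mixOn]; exact mixOn_le_card _ _ _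

/-- Undoes the truncation and the restriction to `S`. Where the density is at least `η`, only the
share of the components outside `S` is lost; where it is below `η`, the whole left side is at most
`√η + M η`, because the slope is at most the root of the density. -/
lemma abs_slope_add_le (hn : 0 < n) (ha : a ∈ Set.Ioo (0 : ℝ) 1) (hη : 0 < η) {M : ℝ} (hMK : M ≤ K)
    {z : ℝ}
    (hz : |z| ≤ M) :
    |mixSlope v z + a * z * mixDensity v z| ≤ truncScore v a η K z * mixOn S v z
      + (√((Sᶜ.card : ℝ) / n) + M * ((Sᶜ.card : ℝ) / n) + √η + M * η) := by
  have hf := mixDensity_pos v hn z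
  have hs := mixOn_nonneg S v z
  have hsf := mixOn_le_mixDensity S v z
  have hm := mixDensity_sub_mixOn_le S v z
  have hN : |mixSlope v z + a * z * mixDensity v z|
      ≤ √(mixDensity v z) + M * mixDensity v z := by
    refine (abs_add_le _ _).trans (add_le_add (abs_mixSlope_le_sqrt v z) ?_)
    rw [abs_mul, abs_mul, abs_of_pos hf, abs_of_pos ha.1]
    gcongr
    nlinarith [ha.1, ha.2, abs_nonneg z]
  rw [truncScore, cutoff_eq_one (hz.trans hMK), mul_one]
  set f := mixDensity v z
  set s := mixOn S v z
  set m := (Sᶜ.card : ℝ) / n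
  have hM : 0 ≤ M := (abs_nonneg z).trans hz
  have hm0 : 0 ≤ m := by positivity
  rcases le_total η f with h | h
  · rw [max_eq_left h]
    -- Split the mass as `1 = s / f + (f - s) / f`; the second share is multiplied by at most `√f +
    -- M f`, which cancels the division by `f`.
    have h1 : |mixSlope v z + a * z * f| = |mixSlope v z + a * z * f| / f * s
        + |mixSlope v z + a * z * f| * ((f - s) / f) := by field_simp; ring
    have h2 : |mixSlope v z + a * z * f| * ((f - s) / f) ≤ √m + M * m := by
      have hq : 0 ≤ (f - s) / f := div_nonneg (by linarith) hf.le
      calc _ ≤ (√f + M * f) * ((f - s) / f) := by gcongr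
        _ = (f - s) / √f + M * (f - s) := by
          have h3 : √f * √f = f := Real.mul_self_sqrt hf.le
          have h4 : 0 < √f := Real.sqrt_pos.2 hf
          rw [add_mul]
          congr 1
          · nth_rewrite 3 [← h3]; field_simp
          · field_simp
        _ ≤ √m + M * m := by
          gcongr
          calc (f - s) / √f ≤ √(f - s) := by
                rw [div_le_iff₀ (Real.sqrt_pos.2 hf)]
                calc f - s = √(f - s) * √(f - s) := (Real.mul_self_sqrt (by linarith)).symm
                  _ ≤ _ := by gcongr; linarith
            _ ≤ √m := by gcongr
    have h3 : 0 ≤ √η := Real.sqrt_nonneg _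
    have := mul_nonneg hM hη.le
    linarith
  · have h1 : 0 ≤ |mixSlope v z + a * z * f| / max f η * s := by positivity
    have h2 : √f ≤ √η := by gcongr
    have h3 : M * f ≤ M * η := by gcongr
    have h4 : 0 ≤ √m := Real.sqrt_nonneg _
    have h5 := mul_nonneg hM hm0
    linarith

lemma integral_abs_slope_add_le (hn : 0 < n) (ha : a ∈ Set.Ioo (0 : ℝ) 1) (hη : 0 < η) {M : ℝ}
    (hM : 0 ≤ M) (hMK : M ≤ K) :
    ∫ z in Set.Icc (-M) M, |mixSlope v z + a * z * mixDensity v z|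
      ≤ (∫ z, truncScore v a η K z * mixOn S v z)
      + 2 * M * (√((Sᶜ.card : ℝ) / n) + M * ((Sᶜ.card : ℝ) / n) + √η + M * η) := by
  have hc1 := continuous_mixSlope v
  have hc2 := continuous_mixDensity v
  have hI := integrable_truncScore_mul S v (a := a) (K := K) hη
  calc _ ≤ ∫ z in Set.Icc (-M) M, (truncScore v a η K z * mixOn S v z
      + (√((Sᶜ.card : ℝ) / n) + M * ((Sᶜ.card : ℝ) / n) + √η + M * η)) := by
        refine setIntegral_mono_on (Continuous.integrableOn_Icc (by fun_prop))
          (hI.integrableOn.add (by simp)) measurableSet_Icc fun z hz => ?_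
        exact abs_slope_add_le S v hn ha hη hMK (abs_le.2 hz)
    _ = (∫ z in Set.Icc (-M) M, truncScore v a η K z * mixOn S v z)
      + 2 * M * (√((Sᶜ.card : ℝ) / n) + M * ((Sᶜ.card : ℝ) / n) + √η + M * η) := by
        rw [integral_add hI.integrableOn (by simp)]
        simp only [integral_const, smul_eq_mul, MeasurableSet.univ, measureReal_restrict_apply,
          Set.univ_inter, Real.volume_real_Icc]
        rw [max_eq_left (by linarith)]
        ring
    _ ≤ _ := by
        gcongr ?_ + _
        exact setIntegral_le_integral hI (ae_of_all _ fun z =>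
          mul_nonneg (truncScore_nonneg v hη z) (mixOn_nonneg S v z))

/-- Integrating factor: the derivative of `f * exp (a z²/2)` is `(f' + a z f) * exp (a z²/2)`, and
the exponential is at most `exp (M²/2)` on `[-M, M]` since `a < 1`. -/
lemma abs_mixDensity_mul_exp_sub_le (ha : a ∈ Set.Ioo (0 : ℝ) 1) {M z : ℝ} (hz : |z| ≤ M) :
    |mixDensity v z * Real.exp (a * z ^ 2 / 2) - mixDensity v 0|
      ≤ Real.exp (M ^ 2 / 2)
        * ∫ z in Set.Icc (-M) M, |mixSlope v z + a * z * mixDensity v z| := by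
  have hc1 := continuous_mixSlope v
  have hc2 := continuous_mixDensity v
  have hd : ∀ y ∈ Set.uIcc 0 z, HasDerivAt
      (fun z => mixDensity v z * Real.exp (a * z ^ 2 / 2))
      ((fun z => (mixSlope v z + a * z * mixDensity v z) * Real.exp (a * z ^ 2 / 2)) y) y :=
    fun z _ => by
    have h1 : HasDerivAt (fun z : ℝ => Real.exp (a * z ^ 2 / 2))
        (Real.exp (a * z ^ 2 / 2) * (a * (2 * z) / 2)) z := by
      have := (((hasDerivAt_pow 2 z).const_mul a).div_const 2).exp
      convert! this using 1
      simp
    have := (hasDerivAt_mixDensity v z).mul h1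
    convert! this using 1
    ring
  have hint := intervalIntegral.integral_eq_sub_of_hasDerivAt hd
    (Continuous.intervalIntegrable (by fun_prop) _ _)
  simp only [ne_eq, OfNat.ofNat_ne_zero, not_false_eq_true, zero_pow, mul_zero, zero_div,
    Real.exp_zero, mul_one] at hint
  rw [← hint, ← Real.norm_eq_abs]
  refine (intervalIntegral.norm_integral_le_integral_norm_uIoc).trans ?_
  have hsub : Set.uIoc 0 z ⊆ Set.Icc (-M) M := by
    intro x hx
    have := abs_le.1 hz
    rcases Set.mem_uIoc.1 hx with h | h <;> constructor <;> linarith [h.1, h.2]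
  rw [← integral_const_mul]
  refine (setIntegral_mono_set (Continuous.integrableOn_Icc (by fun_prop))
    (ae_of_all _ fun x => norm_nonneg _) (Eventually.of_forall hsub)).trans ?_
  refine setIntegral_mono_on (Continuous.integrableOn_Icc (by fun_prop))
    (Continuous.integrableOn_Icc (by fun_prop)) measurableSet_Icc fun x hx => ?_
  rw [norm_mul, mul_comm, Real.norm_eq_abs, Real.norm_eq_abs, abs_of_pos (Real.exp_pos _)]
  gcongr
  have h1 : x ^ 2 ≤ M ^ 2 := sq_le_sq' (by linarith [hx.1]) hx.2
  nlinarith [ha.1, ha.2, sq_nonneg x]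

/-- Tightness from the approximate equation: for `|z| > R`, `a R f ≤ |f' + a z f| + |f'|`, and `∫
|f'| ≤ 1`. The other terms pay for `|z| > K`, for the components outside `S`, and for the part of
`[-K, K]` where `f < η`. -/
lemma tail_mixDensity_le (hn : 0 < n) (ha : 0 < a) (hη : 0 < η) (hK : 0 ≤ K) {R : ℝ} (hR : 0 < R) :
    ∫ z in {z | R < |z|}, mixDensity v z ≤ (∫ z in {z | K < |z|}, mixDensity v z)
      + (Sᶜ.card : ℝ) / n + 2 * K * η
      + (a * R)⁻¹ * ((∫ z, truncScore v a η K z * mixOn S v z) + 1) := by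
  have hI := integrable_truncScore_mul S v (a := a) (K := K) hη
  have hf := integrable_mixDensity v
  have hs := integrable_mixOn S v
  have hm : ∀ r : ℝ, MeasurableSet {z : ℝ | r < |z|} := fun r =>
    measurableSet_lt measurable_const (by fun_prop)
  have hle : ∀ z, {z : ℝ | R < |z|}.indicator (mixDensity v) z
      ≤ {z : ℝ | K < |z|}.indicator (mixDensity v) z + mixOn Sᶜ v z
        + (Set.Icc (-K) K).indicator (fun _ => η) z
        + (a * R)⁻¹ * (truncScore v a η K z * mixOn S v z + |mixSlope v z|) := by
    intro z
    have h1 : 0 ≤ {z : ℝ | K < |z|}.indicator (mixDensity v) z :=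
      Set.indicator_nonneg (fun _ _ => mixDensity_nonneg _ _) _
    have h2 := mixOn_nonneg Sᶜ v z
    have h3 : 0 ≤ (Set.Icc (-K) K).indicator (fun _ => η) z :=
      Set.indicator_nonneg (fun _ _ => hη.le) _
    have h4 : 0 ≤ (a * R)⁻¹ * (truncScore v a η K z * mixOn S v z + |mixSlope v z|) :=
      mul_nonneg (by positivity) (add_nonneg (mul_nonneg (truncScore_nonneg v hη z)
        (mixOn_nonneg S v z)) (abs_nonneg _))
    by_cases hzR : R < |z|
    · rw [Set.indicator_of_mem (by exact hzR)]
      by_cases hzK : K < |z|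
      · rw [Set.indicator_of_mem (by exact hzK)]
        linarith
      · rcases le_total η (mixDensity v z) with hh | hh
        · have h5 : mixOn S v z
              ≤ (a * R)⁻¹ * (truncScore v a η K z * mixOn S v z + |mixSlope v z|) := by
            rw [inv_mul_eq_div, le_div_iff₀ (by positivity), truncScore,
              cutoff_eq_one (not_lt.1 hzK), max_eq_left hh, mul_one]
            have hfz := mixDensity_pos v hn z
            have hsz := mixOn_nonneg S v z
            have hsf := mixOn_le_mixDensity S v z
            have h6 : a * R * mixDensity v z
                ≤ |mixSlope v z + a * z * mixDensity v z| + |mixSlope v z| := by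
              calc a * R * mixDensity v z ≤ a * |z| * mixDensity v z := by gcongr
                _ = |a * z * mixDensity v z| := by
                  rw [abs_mul, abs_mul, abs_of_pos ha, abs_of_pos hfz]
                _ = |(mixSlope v z + a * z * mixDensity v z) - mixSlope v z| := by
                  congr 1; ring
                _ ≤ _ := abs_sub _ _
            have h7 : mixOn S v z / mixDensity v z ≤ 1 := (div_le_one hfz).2 hsf
            have h8 : 0 ≤ mixOn S v z / mixDensity v z := by positivity
            calc mixOn S v z * (a * R)
                = (a * R * mixDensity v z) * (mixOn S v z / mixDensity v z) := by field_simp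
              _ ≤ (|mixSlope v z + a * z * mixDensity v z| + |mixSlope v z|)
                  * (mixOn S v z / mixDensity v z) := by gcongr
              _ = |mixSlope v z + a * z * mixDensity v z| / mixDensity v z * mixOn S v z
                  + |mixSlope v z| * (mixOn S v z / mixDensity v z) := by field_simp
              _ ≤ _ := by
                gcongr
                exact mul_le_of_le_one_right (abs_nonneg _) h7
          have h9 := mixDensity_sub_mixOn S v z
          linarith
        · have h5 : (Set.Icc (-K) K).indicator (fun _ => η) z = η :=
            Set.indicator_of_mem (Set.mem_Icc.2 (abs_le.1 (not_lt.1 hzK))) _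
          linarith
    · rw [Set.indicator_of_notMem (by exact hzR)]
      linarith
  have hInd : Integrable ((Set.Icc (-K) K).indicator fun _ => η) :=
    (integrable_indicator_iff measurableSet_Icc).2 (by simp)
  have hA := (hf.indicator (hm K)).add (integrable_mixOn Sᶜ v)
  have hC := (hI.add (integrable_abs_mixSlope v)).const_mul (a * R)⁻¹
  rw [← integral_indicator (hm R), ← integral_indicator (hm K)]
  refine (integral_mono (hf.indicator (hm R)) ((hA.add hInd).add hC) hle).trans ?_
  simp only [Pi.add_apply]
  have e1 := integral_add (hA.add hInd) hC
  have e2 := integral_add hA hInd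
  have e3 := integral_add (hf.indicator (hm K)) (integrable_mixOn Sᶜ v)
  have e4 := integral_add hI (integrable_abs_mixSlope v)
  simp only [Pi.add_apply] at e1 e2 e3 e4
  rw [e1, e2, e3, integral_const_mul, e4, integral_mixOn, integral_indicator measurableSet_Icc]
  have e5 : ∫ z in Set.Icc (-K) K, η = 2 * K * η := by
    simp only [integral_const, smul_eq_mul, MeasurableSet.univ, measureReal_restrict_apply,
      Set.univ_inter, Real.volume_real_Icc]
    rw [max_eq_left (by linarith)]; ring
  rw [e5]
  gcongr
  exact integral_abs_mixSlope_le v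

/-! ### Empirical measures -/

lemma isProbabilityMeasure_empirical (hn : 0 < n) : IsProbabilityMeasure (empirical v) := by
  constructor
  simp [empirical, ENNReal.inv_mul_cancel, hn.ne']

lemma integral_empirical {E : Type*} [NormedAddCommGroup E] [NormedSpace ℝ E] [CompleteSpace E]
    (g : ℝ → E) : ∫ x, g x ∂(empirical v) = (n : ℝ)⁻¹ • ∑ i, g (v i) := by
  rw [empirical, integral_smul_measure, integral_finsetSum_measure]
  · simp
  · intro i _
    exact integrable_dirac (by simp)

/-- The mixture is the law of a point drawn from the empirical measure plus independent standard
normal noise, so characteristic functions multiply. -/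
lemma charFun_empirical_mul (t : ℝ) :
    charFun (empirical v) t * charFun γ t
      = ∫ z, (mixDensity v z : ℂ) * Complex.exp (t * z * Complex.I) := by
  rw [charFun_apply_real, charFun_apply_real, integral_empirical,
    integral_gaussianReal_eq_integral_smul one_ne_zero]
  have hsum : ∀ i, ∫ z, (φ (z - v i) : ℂ) * Complex.exp (t * z * Complex.I)
      = Complex.exp (t * v i * Complex.I) * ∫ x, φ x • Complex.exp (t * x * Complex.I) := by
    intro i
    rw [← integral_sub_right_eq_self
      (fun x : ℝ => φ x • Complex.exp (t * x * Complex.I)) (v i), ← integral_const_mul]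
    congr 1 with z
    rw [Complex.real_smul, mul_left_comm, ← Complex.exp_add]
    congr 2
    push_cast; ring
  have hint : ∀ i, Integrable fun z => (φ (z - v i) : ℂ) * Complex.exp (t * z * Complex.I) := by
    intro i
    refine (integrable_stdPDF.comp_sub_right (v i)).mono
      (Continuous.aestronglyMeasurable ?_) (ae_of_all _ fun z => ?_)
    · have := continuous_stdPDF
      fun_prop
    · have : Complex.exp (t * z * Complex.I) = Complex.exp ((t * z : ℝ) * Complex.I) := by
        push_cast; rfl
      rw [norm_mul, this, Complex.norm_exp_ofReal_mul_I]
      simp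
  unfold mixDensity
  push_cast
  simp_rw [mul_assoc _ (∑ i, _) _, Finset.sum_mul]
  rw [integral_const_mul, integral_finsetSum _ fun i _ => hint i]
  simp_rw [hsum, ← Finset.sum_mul]
  rw [Complex.real_smul]
  push_cast
  ring

/-- A point in `[-R, R]` contributes at least `φ R / n` to the mixture density at `0`, so a small
value there forces most points out of `[-R, R]`, where `g` is small. -/
lemma abs_integral_empirical_le (hn : 0 < n) {g : ℝ → ℝ} {C e R : ℝ} (hC : ∀ x, |g x| ≤ C)
    (he : 0 ≤ e) (hR : ∀ x, R < |x| → |g x| ≤ e) :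
    |∫ x, g x ∂(empirical v)| ≤ C / φ R * mixDensity v 0 + e := by
  have hC0 : 0 ≤ C := (abs_nonneg _).trans (hC 0)
  have hR0 := stdPDF_pos R
  have hpt : ∀ x, |g x| ≤ C / φ R * φ (0 - x) + e := by
    intro x
    by_cases hx : R < |x|
    · exact (hR x hx).trans (le_add_of_nonneg_left (mul_nonneg (by positivity) (stdPDF_nonneg _)))
    · have h1 : φ R ≤ φ (0 - x) := by
        rw [zero_sub, stdPDF_neg, stdPDF_eq, stdPDF_eq]
        gcongr 2
        have : x ^ 2 ≤ R ^ 2 := sq_le_sq.2 ((not_lt.1 hx).trans (le_abs_self R))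
        linarith
      have h2 : C ≤ C / φ R * φ (0 - x) := by
        rw [div_mul_eq_mul_div, le_div_iff₀ hR0]; gcongr
      linarith [hC x]
  have hn' : (n : ℝ) ≠ 0 := by exact_mod_cast hn.ne'
  rw [integral_empirical, smul_eq_mul, abs_mul, abs_of_nonneg (by positivity : 0 ≤ (n : ℝ)⁻¹)]
  calc _ ≤ (n : ℝ)⁻¹ * ∑ i, (C / φ R * φ (0 - v i) + e) := by
        gcongr
        exact (Finset.abs_sum_le_sum_abs _ _).trans (Finset.sum_le_sum fun i _ => hpt _)
    _ = _ := by
        rw [Finset.sum_add_distrib, ← Finset.mul_sum, mixDensity]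
        simp only [Finset.sum_const, Finset.card_univ, Fintype.card_fin, nsmul_eq_mul]
        field_simp

end Static

/-! ### Centred normal laws with converging variance -/

lemma integral_gaussianReal_eq_integral_sqrt_mul (g : ℝ → ℝ) (hg : Continuous g) (s : ℝ≥0) :
    ∫ x, g x ∂(gaussianReal 0 s) = ∫ x, g (√(s : ℝ) * x) ∂γ := by
  have h := gaussianReal_map_const_mul (μ := 0) (v := 1) (√(s : ℝ))
  have hs : NNReal.mk (√(s : ℝ) ^ 2) (sq_nonneg _) = s := by
    ext; exact Real.sq_sqrt s.2
  rw [mul_zero, mul_one, hs] at h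
  rw [← h, integral_map (by fun_prop) hg.aestronglyMeasurable]

lemma tendsto_integral_gaussianReal {ι : Type*} {l : Filter ι} [l.IsCountablyGenerated]
    {g : ℝ → ℝ} (hg : Continuous g) {C : ℝ}
    (hC : ∀ x, |g x| ≤ C) {s : ι → ℝ≥0} {s₀ : ℝ≥0} (hs : Tendsto s l (𝓝 s₀)) :
    Tendsto (fun k => ∫ x, g x ∂(gaussianReal 0 (s k))) l
      (𝓝 (∫ x, g x ∂(gaussianReal 0 s₀))) := by
  simp_rw [integral_gaussianReal_eq_integral_sqrt_mul g hg]
  refine tendsto_integral_filter_of_dominated_convergence (fun _ => C)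
    (Eventually.of_forall fun k => by fun_prop)
    (Eventually.of_forall fun k => ae_of_all _ fun x => hC _) (integrable_const C)
    (ae_of_all _ fun x => ?_)
  have h1 : Tendsto (fun k => (s k : ℝ)) l (𝓝 s₀) := NNReal.tendsto_coe.2 hs
  exact (hg.tendsto _).comp (((Real.continuous_sqrt.tendsto _).comp h1).mul_const x)

/-- After rescaling to a fixed standard normal `x`, the argument `√s * x` leaves every compact set
unless `x = 0`, which has probability zero; dominated convergence applies. -/
lemma tendsto_integral_gaussianReal_zero {ι : Type*} {l : Filter ι} [l.IsCountablyGenerated]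
    {g : ℝ → ℝ} (hg : Continuous g) {C : ℝ}
    (hC : ∀ x, |g x| ≤ C) (hg0 : Tendsto g (cocompact ℝ) (𝓝 0)) {s : ι → ℝ≥0}
    (hs : Tendsto s l atTop) :
    Tendsto (fun k => ∫ x, g x ∂(gaussianReal 0 (s k))) l (𝓝 0) := by
  simp_rw [integral_gaussianReal_eq_integral_sqrt_mul g hg]
  have h0 : (0 : ℝ) = ∫ _, (0 : ℝ) ∂γ := by simp
  nth_rewrite 2 [h0]
  refine tendsto_integral_filter_of_dominated_convergence (fun _ => C)
    (Eventually.of_forall fun k => by fun_prop)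
    (Eventually.of_forall fun k => ae_of_all _ fun x => hC _) (integrable_const C) ?_
  have := nullSingletonClass_gaussianReal (μ := 0) one_ne_zero
  have hne : ∀ᵐ x ∂γ, x ≠ 0 := by
    rw [ae_iff]
    simp
  filter_upwards [hne] with x hx
  refine hg0.comp ?_
  rw [← Metric.cobounded_eq_cocompact, ← tendsto_norm_atTop_iff_cobounded]
  have h1 : Tendsto (fun k => (s k : ℝ)) l atTop := NNReal.tendsto_coe_atTop.2 hs
  have h2 := (Real.tendsto_sqrt_atTop.comp h1).atTop_mul_const (abs_pos.2 hx)
  refine h2.congr fun k => ?_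
  simp [abs_of_nonneg (Real.sqrt_nonneg _)]

/-! ### Limits of sequences of configurations with vanishing score discrepancy -/

section Sequences

variable {n : ℕ → ℕ} {v : ∀ k, Fin (n k) → ℝ} {S : ∀ k, Finset (Fin (n k))} {a η K : ℕ → ℝ}
  {a₀ c : ℝ}

lemma tendsto_mixDensity_mul_exp_sub (hn : ∀ k, 0 < n k) (ha : ∀ k, a k ∈ Set.Ioo (0 : ℝ) 1)
    (hη : ∀ k, 0 < η k) (hη0 : Tendsto η atTop (𝓝 0)) (hK : Tendsto K atTop atTop)
    (hS : Tendsto (fun k => ((S k)ᶜ.card : ℝ) / n k) atTop (𝓝 0))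
    (hD : Tendsto (fun k => ∫ z, truncScore (v k) (a k) (η k) (K k) z * mixOn (S k) (v k) z)
      atTop (𝓝 0)) (z : ℝ) :
    Tendsto (fun k => mixDensity (v k) z * Real.exp (a k * z ^ 2 / 2) - mixDensity (v k) 0)
      atTop (𝓝 0) := by
  rw [tendsto_zero_iff_abs_tendsto_zero]
  have hlim : Tendsto (fun k => Real.exp (|z| ^ 2 / 2)
      * ((∫ z, truncScore (v k) (a k) (η k) (K k) z * mixOn (S k) (v k) z)
      + 2 * |z| * (√(((S k)ᶜ.card : ℝ) / n k) + |z| * (((S k)ᶜ.card : ℝ) / n k)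
        + √(η k) + |z| * η k))) atTop (𝓝 0) := by
    have h1 := (Real.continuous_sqrt.tendsto 0).comp hS
    have h2 := (Real.continuous_sqrt.tendsto 0).comp hη0
    have h3 := (hD.add ((((h1.add (hS.const_mul |z|)).add h2).add
      (hη0.const_mul |z|)).const_mul (2 * |z|))).const_mul (Real.exp (|z| ^ 2 / 2))
    simpa using h3
  refine tendsto_of_tendsto_of_tendsto_of_le_of_le' tendsto_const_nhds hlim
    (Eventually.of_forall fun k => abs_nonneg _) ?_
  filter_upwards [hK.eventually_ge_atTop |z|] with k hk
  refine (abs_mixDensity_mul_exp_sub_le (v k) (ha k) le_rfl).trans ?_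
  gcongr
  exact integral_abs_slope_add_le (S k) (v k) (hn k) (ha k) (hη k) (abs_nonneg z) hk

lemma tendsto_mixDensity (h : ∀ z, Tendsto (fun k => mixDensity (v k) z
      * Real.exp (a k * z ^ 2 / 2) - mixDensity (v k) 0) atTop (𝓝 0))
    (ha₀ : Tendsto a atTop (𝓝 a₀)) (hc : Tendsto (fun k => mixDensity (v k) 0) atTop (𝓝 c))
    (z : ℝ) :
    Tendsto (fun k => mixDensity (v k) z) atTop (𝓝 (c * Real.exp (-(a₀ / 2) * z ^ 2))) := by
  have h1 := (h z).add hc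
  have h2 : Tendsto (fun k => Real.exp (-(a k / 2) * z ^ 2)) atTop
      (𝓝 (Real.exp (-(a₀ / 2) * z ^ 2))) :=
    (Real.continuous_exp.tendsto _).comp ((ha₀.div_const 2).neg.mul_const _)
  have h3 := h1.mul h2
  rw [zero_add] at h3
  refine h3.congr fun k => ?_
  rw [sub_add_cancel, mul_assoc, ← Real.exp_add]
  have : a k * z ^ 2 / 2 + -(a k / 2) * z ^ 2 = 0 := by ring
  rw [this, Real.exp_zero, mul_one]

lemma setIntegral_mixDensity_le_one {n : ℕ} (hn : 0 < n) (v : Fin n → ℝ) (s : Set ℝ) :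
    ∫ z in s, mixDensity v z ≤ 1 :=
  (setIntegral_le_integral (integrable_mixDensity v)
    (ae_of_all _ fun z => mixDensity_nonneg v z)).trans_eq (integral_mixDensity v hn)

/-- A positive limit `c` would put mass `2` on the interval `[-c⁻¹, c⁻¹]`, whereas every mixture has
total mass `1`. -/
lemma limit_eq_zero (hn : ∀ k, 0 < n k) (hc0 : 0 ≤ c)
    (h : ∀ z, Tendsto (fun k => mixDensity (v k) z) atTop (𝓝 c)) : c = 0 := by
  by_contra hne
  have hcpos : 0 < c := lt_of_le_of_ne hc0 (Ne.symm hne)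
  have hlim : Tendsto (fun k => ∫ z in Set.Icc (-c⁻¹) c⁻¹, mixDensity (v k) z) atTop
      (𝓝 (∫ z in Set.Icc (-c⁻¹) c⁻¹, c)) := by
    refine tendsto_integral_of_dominated_convergence (fun _ => 1)
      (fun k => (continuous_mixDensity (v k)).aestronglyMeasurable) (by simp)
      (fun k => ae_of_all _ fun z => ?_) (ae_of_all _ h)
    rw [Real.norm_eq_abs, abs_of_nonneg (mixDensity_nonneg _ _)]
    exact mixDensity_le_one _ _
  have hle := le_of_tendsto' hlim fun k => setIntegral_mixDensity_le_one (hn k) (v k) _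
  have hcinv : 0 < c⁻¹ := inv_pos.2 hcpos
  simp only [integral_const, smul_eq_mul, MeasurableSet.univ, measureReal_restrict_apply,
    Set.univ_inter, Real.volume_real_Icc] at hle
  rw [max_eq_left (by linarith)] at hle
  have : (c⁻¹ - -c⁻¹) * c = 2 := by field_simp; norm_num
  linarith

lemma integrable_const_mul_exp (ha₀ : 0 < a₀) :
    Integrable fun z : ℝ => c * Real.exp (-(a₀ / 2) * z ^ 2) :=
  (integrable_exp_neg_mul_sq (by positivity)).const_mul c

lemma exists_tail_exp_le (ha₀ : 0 < a₀) (hc0 : 0 ≤ c) :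
    ∃ B : ℝ, ∀ R : ℝ, 0 < R →
      ∫ z in {z : ℝ | R < |z|}, c * Real.exp (-(a₀ / 2) * z ^ 2) ≤ B / R := by
  refine ⟨∫ z : ℝ, c * |z * Real.exp (-(a₀ / 2) * z ^ 2)|, fun R hR => ?_⟩
  have hi : Integrable fun z : ℝ => c * |z * Real.exp (-(a₀ / 2) * z ^ 2)| :=
    ((integrable_mul_exp_neg_mul_sq (by positivity)).abs).const_mul c
  have hm : MeasurableSet {z : ℝ | R < |z|} := measurableSet_lt measurable_const (by fun_prop)
  rw [div_eq_inv_mul _ R, ← integral_const_mul, ← integral_indicator hm]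
  refine integral_mono ((integrable_const_mul_exp ha₀).indicator hm) (hi.const_mul _) fun z => ?_
  by_cases hz : R < |z|
  · rw [Set.indicator_of_mem (by exact hz), abs_mul, abs_of_pos (Real.exp_pos _),
      inv_mul_eq_div, le_div_iff₀ hR]
    calc c * Real.exp (-(a₀ / 2) * z ^ 2) * R ≤ c * Real.exp (-(a₀ / 2) * z ^ 2) * |z| := by
          gcongr
      _ = _ := by ring
  · rw [Set.indicator_of_notMem (by exact hz)]
    positivity

/-- Pointwise convergence is upgraded to `L¹`: dominated convergence on `[-R, R]`, and tails of
order `1 / R` uniformly for large `k`. Positivity of `a₀` is what prevents loss of mass. -/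
lemma tendsto_integral_abs_mixDensity_sub (hn : ∀ k, 0 < n k)
    (ha : ∀ k, a k ∈ Set.Ioo (0 : ℝ) 1)
    (hη : ∀ k, 0 < η k) (hK0 : ∀ k, 0 ≤ K k) (hKη : Tendsto (fun k => K k * η k) atTop (𝓝 0))
    (hS : Tendsto (fun k => ((S k)ᶜ.card : ℝ) / n k) atTop (𝓝 0))
    (hD : Tendsto (fun k => ∫ z, truncScore (v k) (a k) (η k) (K k) z * mixOn (S k) (v k) z)
      atTop (𝓝 0))
    (htail : Tendsto (fun k => ∫ z in {z | K k < |z|}, mixDensity (v k) z) atTop (𝓝 0))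
    (ha₀ : Tendsto a atTop (𝓝 a₀)) (ha₀pos : 0 < a₀) (hc0 : 0 ≤ c)
    (h : ∀ z, Tendsto (fun k => mixDensity (v k) z) atTop
      (𝓝 (c * Real.exp (-(a₀ / 2) * z ^ 2)))) :
    Tendsto (fun k => ∫ z, |mixDensity (v k) z - c * Real.exp (-(a₀ / 2) * z ^ 2)|) atTop
      (𝓝 0) := by
  obtain ⟨B, hB⟩ := exists_tail_exp_le ha₀pos hc0
  set F : ℝ → ℝ := fun z => c * Real.exp (-(a₀ / 2) * z ^ 2) with hF
  have hFi : Integrable F := integrable_const_mul_exp ha₀pos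
  have hF0 : ∀ z, 0 ≤ F z := fun z => by positivity
  have hFc : ∀ z, F z ≤ c := fun z => by
    refine mul_le_of_le_one_right hc0 (Real.exp_le_one_iff.2 ?_)
    nlinarith [sq_nonneg z]
  have hm : ∀ R : ℝ, MeasurableSet {z : ℝ | R < |z|} := fun R =>
    measurableSet_lt measurable_const (by fun_prop)
  have hkey : ∀ R : ℝ, 0 < R → ∀ k, ∫ z, |mixDensity (v k) z - F z|
      ≤ (∫ z in Set.Icc (-R) R, |mixDensity (v k) z - F z|)
        + ((∫ z in {z | K k < |z|}, mixDensity (v k) z) + ((S k)ᶜ.card : ℝ) / n k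
          + 2 * K k * η k + (a k * R)⁻¹
            * ((∫ z, truncScore (v k) (a k) (η k) (K k) z * mixOn (S k) (v k) z) + 1))
        + B / R := by
    intro R hR k
    have hd : Integrable fun z => |mixDensity (v k) z - F z| :=
      ((integrable_mixDensity (v k)).sub hFi).abs
    have hcompl : (Set.Icc (-R) R)ᶜ = {z : ℝ | R < |z|} := by
      ext z
      simp only [Set.mem_compl_iff, Set.mem_ofPred_eq, Set.mem_Icc, ← abs_le, not_le]
    rw [← integral_add_compl (measurableSet_Icc (a := -R) (b := R)) hd, hcompl, add_assoc]
    gcongr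
    calc ∫ z in {z | R < |z|}, |mixDensity (v k) z - F z|
        ≤ ∫ z in {z | R < |z|}, (mixDensity (v k) z + F z) := by
          refine integral_mono hd.integrableOn
            ((integrable_mixDensity (v k)).add hFi).integrableOn fun z => ?_
          refine (abs_sub _ _).trans_eq ?_
          rw [abs_of_nonneg (hF0 z), abs_of_nonneg (mixDensity_nonneg _ _)]
      _ = (∫ z in {z | R < |z|}, mixDensity (v k) z) + ∫ z in {z | R < |z|}, F z :=
          integral_add (integrable_mixDensity (v k)).integrableOn hFi.integrableOn
      _ ≤ _ := by
          gcongr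
          · exact tail_mixDensity_le (S k) (v k) (hn k) (ha k).1 (hη k) (hK0 k) hR
          · exact hB R hR
  rw [tendsto_order]
  refine ⟨fun x hx => Eventually.of_forall fun k => hx.trans_le
    (integral_nonneg fun z => abs_nonneg _), fun e he => ?_⟩
  -- For fixed `R` all other terms of `hkey` vanish as `k → ∞`, leaving exactly this sum.
  have hex : ∃ R : ℝ, 0 < R ∧ (a₀ * R)⁻¹ + B / R < e := by
    have h1 : Tendsto (fun R : ℝ => (a₀ * R)⁻¹ + B / R) atTop (𝓝 0) := by
      simpa using (tendsto_inv_atTop_zero.comp (tendsto_id.const_mul_atTop ha₀pos)).add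
        (tendsto_id.const_div_atTop B)
    obtain ⟨R, hR⟩ := ((h1.eventually (gt_mem_nhds he)).and (eventually_gt_atTop 0)).exists
    exact ⟨R, hR.2, hR.1⟩
  obtain ⟨R, hR, hRe⟩ := hex
  have hloc : Tendsto (fun k => ∫ z in Set.Icc (-R) R, |mixDensity (v k) z - F z|) atTop
      (𝓝 0) := by
    have h0 : (0 : ℝ) = ∫ z in Set.Icc (-R) R, (0 : ℝ) := by simp
    rw [h0]
    refine tendsto_integral_of_dominated_convergence (fun _ => 1 + c)
      (fun k => ?_) (by simp) (fun k => ae_of_all _ fun z => ?_) (ae_of_all _ fun z => ?_)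
    · have := continuous_mixDensity (v k)
      exact Continuous.aestronglyMeasurable (by fun_prop)
    · rw [Real.norm_eq_abs, abs_abs]
      refine (abs_sub _ _).trans ?_
      rw [abs_of_nonneg (hF0 z), abs_of_nonneg (mixDensity_nonneg _ _)]
      exact add_le_add (mixDensity_le_one _ _) (hFc z)
    · have := ((h z).sub_const (F z)).abs
      simpa [hF] using this
  have hlim := (hloc.add (((htail.add hS).add ((hKη.const_mul 2))).add
    (((ha₀.mul_const R).inv₀ (by positivity)).mul (hD.add_const 1)))).add_const (B / R)
  have hval : 0 + (0 + 0 + 2 * 0 + (a₀ * R)⁻¹ * (0 + 1)) + B / R < e := by simpa using hRe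
  filter_upwards [hlim.eventually (gt_mem_nhds hval)] with k hk
  refine (hkey R hR k).trans_lt ?_
  rw [mul_assoc 2]
  exact hk

/-- The `L¹` limit has mass `1`, which fixes `c` as the normalising constant of `N(0, 1/a₀)`. The
characteristic function of the noise never vanishes and can be divided out, which subtracts `1` from
the variance; `a₀ ≤ 1` keeps the result nonnegative. -/
lemma tendsto_charFun_empirical (hn : ∀ k, 0 < n k) (ha₀pos : 0 < a₀) (ha₀le : a₀ ≤ 1)
    (h : Tendsto (fun k => ∫ z, |mixDensity (v k) z - c * Real.exp (-(a₀ / 2) * z ^ 2)|) atTop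
      (𝓝 0)) (t : ℝ) :
    Tendsto (fun k => charFun (empirical (v k)) t) atTop
      (𝓝 (charFun (gaussianReal 0 (Real.toNNReal ((1 - a₀) / a₀))) t)) := by
  set F : ℝ → ℝ := fun z => c * Real.exp (-(a₀ / 2) * z ^ 2) with hF
  have hFi : Integrable F := integrable_const_mul_exp ha₀pos
  set s : ℝ≥0 := Real.toNNReal (1 / a₀) with hs
  have hsa : (s : ℝ) = 1 / a₀ := Real.coe_toNNReal _ (by positivity)
  have hs0 : s ≠ 0 := by
    intro h0
    rw [h0] at hsa
    have : 0 < 1 / a₀ := by positivity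
    simp only [NNReal.coe_zero] at hsa
    linarith
  have hone : ∫ z, F z = 1 := by
    have h1 : Tendsto (fun k => (∫ z, mixDensity (v k) z) - ∫ z, F z) atTop (𝓝 0) := by
      rw [tendsto_zero_iff_abs_tendsto_zero]
      refine squeeze_zero (fun k => abs_nonneg _) (fun k => ?_) h
      simp only [Function.comp]
      rw [← integral_sub (integrable_mixDensity (v k)) hFi]
      exact abs_integral_le_integral_abs
    simp_rw [integral_mixDensity _ (hn _)] at h1
    have := tendsto_nhds_unique h1 tendsto_const_nhds
    linarith
  have hFpdf : F = gaussianPDFReal 0 s := by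
    have h1 : ∀ z, F z = c * √(2 * Real.pi * s) * gaussianPDFReal 0 s z := by
      intro z
      rw [gaussianPDFReal, hsa]
      have : √(2 * Real.pi * (1 / a₀)) ≠ 0 := by positivity
      rw [mul_assoc, mul_inv_cancel_left₀ this]
      simp only [hF]
      congr 2
      field_simp
      ring
    have h2 : c * √(2 * Real.pi * s) = 1 := by
      rw [← hone]
      simp_rw [h1]
      rw [integral_const_mul, integral_gaussianPDFReal_eq_one 0 hs0, mul_one]
    ext z
    rw [h1, h2, one_mul]
  have hconv : Tendsto (fun k => charFun (empirical (v k)) t * charFun γ t) atTop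
      (𝓝 (charFun (gaussianReal 0 s) t)) := by
    have hnorm : ∀ z : ℝ, ‖Complex.exp (t * z * Complex.I)‖ = 1 := fun z => by
      have : Complex.exp (t * z * Complex.I) = Complex.exp ((t * z : ℝ) * Complex.I) := by
        push_cast; rfl
      rw [this, Complex.norm_exp_ofReal_mul_I]
    have hint : ∀ {f : ℝ → ℝ}, Integrable f →
        Integrable fun z : ℝ => (f z : ℂ) * Complex.exp (t * z * Complex.I) := fun {f} hf =>
      hf.ofReal.mul_bdd (c := 1) (Continuous.aestronglyMeasurable (by fun_prop))
        (ae_of_all _ fun z => (hnorm z).le)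
    have h2 : charFun (gaussianReal 0 s) t
        = ∫ z, (F z : ℂ) * Complex.exp (t * z * Complex.I) := by
      rw [charFun_apply_real, integral_gaussianReal_eq_integral_smul hs0, hFpdf]
      simp_rw [Complex.real_smul]
    rw [h2, tendsto_iff_norm_sub_tendsto_zero]
    refine squeeze_zero (fun k => norm_nonneg _) (fun k => ?_) h
    rw [charFun_empirical_mul, ← integral_sub (hint (integrable_mixDensity (v k))) (hint hFi)]
    refine (norm_integral_le_integral_norm _).trans_eq ?_
    congr 1 with z
    rw [← sub_mul, norm_mul, hnorm, mul_one, ← Complex.ofReal_sub, Complex.norm_real,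
      Real.norm_eq_abs]
  have hγ : charFun γ t ≠ 0 := by
    rw [charFun_gaussianReal]; exact Complex.exp_ne_zero _
  have h3 := hconv.div_const (charFun γ t)
  simp_rw [mul_div_cancel_right₀ _ hγ] at h3
  convert h3 using 2
  rw [charFun_gaussianReal, charFun_gaussianReal, charFun_gaussianReal, ← Complex.exp_sub, hsa]
  rw [Real.coe_toNNReal _ (div_nonneg (by linarith) ha₀pos.le)]
  congr 1
  have : (a₀ : ℂ) ≠ 0 := by exact_mod_cast ha₀pos.ne'
  push_cast
  field_simp
  ring

end Sequences

/-! ### From densities to integrals of test functions -/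

section Sequences

variable {n : ℕ → ℕ} {v : ∀ k, Fin (n k) → ℝ} {S : ∀ k, Finset (Fin (n k))} {a η K : ℕ → ℝ}
  {a₀ c : ℝ}

lemma tendsto_integral_empirical_zero (hn : ∀ k, 0 < n k)
    (h : Tendsto (fun k => mixDensity (v k) 0) atTop (𝓝 0)) {g : ℝ → ℝ} {C : ℝ}
    (hC : ∀ x, |g x| ≤ C) (hg : Tendsto g (cocompact ℝ) (𝓝 0)) :
    Tendsto (fun k => ∫ x, g x ∂(empirical (v k))) atTop (𝓝 0) := by
  rw [Metric.tendsto_atTop']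
  intro e he
  have hev : ∀ᶠ x in cocompact ℝ, |g x| ≤ e / 2 := by
    filter_upwards [hg.eventually (Metric.ball_mem_nhds 0 (half_pos he))] with x hx
    have : |g x| < e / 2 := by simpa using hx
    exact this.le
  rw [← Metric.cobounded_eq_cocompact, ← comap_norm_atTop, eventually_comap] at hev
  obtain ⟨R, hR⟩ := (eventually_atTop.1 hev)
  have hlim := (h.const_mul (C / φ R)).add_const (e / 2)
  rw [mul_zero, zero_add] at hlim
  obtain ⟨N, hN⟩ := eventually_atTop.1 (hlim.eventually (gt_mem_nhds (half_lt_self he)))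
  refine ⟨N, fun k hk => ?_⟩
  rw [Real.dist_eq, sub_zero]
  exact (abs_integral_empirical_le (v k) (hn k) hC (half_pos he).le
    fun x hx => hR |x| hx.le x rfl).trans_lt (hN k hk.le)

lemma tendsto_integral_empirical (hn : ∀ k, 0 < n k) {s : ℝ≥0}
    (h : ∀ t, Tendsto (fun k => charFun (empirical (v k)) t) atTop
      (𝓝 (charFun (gaussianReal 0 s) t))) {g : ℝ → ℝ} (hg : Continuous g) {C : ℝ}
    (hC : ∀ x, |g x| ≤ C) :
    Tendsto (fun k => ∫ x, g x ∂(empirical (v k))) atTop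
      (𝓝 (∫ x, g x ∂(gaussianReal 0 s))) := by
  let μ : ℕ → ProbabilityMeasure ℝ := fun k =>
    ⟨empirical (v k), isProbabilityMeasure_empirical (v k) (hn k)⟩
  let μ₀ : ProbabilityMeasure ℝ := ⟨gaussianReal 0 s, inferInstance⟩
  have h1 : Tendsto μ atTop (𝓝 μ₀) := ProbabilityMeasure.tendsto_of_tendsto_charFun h
  exact ProbabilityMeasure.tendsto_iff_forall_integral_tendsto.1 h1
    (BoundedContinuousFunction.ofNormedAddCommGroup g hg C hC)

/-- Two regimes. For `a₀ > 0` both integrals tend to the integral against `N(0, (1 - a₀)/a₀)`. For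
`a₀ = 0` the density flattens to `0`, the normal variance diverges, and both integrals tend to `0`
when `g` vanishes at infinity. -/
lemma tendsto_gap_of_tendsto (hn : ∀ k, 0 < n k) (ha : ∀ k, a k ∈ Set.Ioo (0 : ℝ) 1)
    (hη : ∀ k, 0 < η k) (hη0 : Tendsto η atTop (𝓝 0))
    (hK0 : ∀ k, 0 ≤ K k) (hK : Tendsto K atTop atTop)
    (hKη : Tendsto (fun k => K k * η k) atTop (𝓝 0))
    (hS : Tendsto (fun k => ((S k)ᶜ.card : ℝ) / n k) atTop (𝓝 0))
    (hD : Tendsto (fun k => ∫ z, truncScore (v k) (a k) (η k) (K k) z * mixOn (S k) (v k) z)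
      atTop (𝓝 0))
    (htail : Tendsto (fun k => ∫ z in {z | K k < |z|}, mixDensity (v k) z) atTop (𝓝 0))
    (ha₀ : Tendsto a atTop (𝓝 a₀)) (hc : Tendsto (fun k => mixDensity (v k) 0) atTop (𝓝 c))
    {g : ℝ → ℝ} (hg : Continuous g) {C : ℝ} (hC : ∀ x, |g x| ≤ C)
    (hcase : 0 < a₀ ∨ Tendsto g (cocompact ℝ) (𝓝 0)) :
    Tendsto (fun k => (∫ x, g x ∂(empirical (v k)))
      - ∫ x, g x ∂(gaussianReal 0 (Real.toNNReal ((1 - a k) / a k)))) atTop (𝓝 0) := by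
  have hlim := tendsto_mixDensity
    (tendsto_mixDensity_mul_exp_sub hn ha hη hη0 hK hS hD) ha₀ hc
  have hc0 : 0 ≤ c := ge_of_tendsto' hc fun k => mixDensity_nonneg _ _
  have ha0 : 0 ≤ a₀ := ge_of_tendsto' ha₀ fun k => (ha k).1.le
  have ha1 : a₀ ≤ 1 := le_of_tendsto' ha₀ fun k => (ha k).2.le
  rcases ha0.eq_or_lt with h0 | hpos
  · have hg0 := hcase.resolve_left (by rw [← h0]; exact lt_irrefl _)
    have hc' : c = 0 := by
      refine limit_eq_zero (v := v) hn hc0 fun z => ?_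
      have := hlim z
      rw [← h0] at this
      simpa using this
    rw [hc'] at hc
    have hinf : Tendsto (fun k => Real.toNNReal ((1 - a k) / a k)) atTop atTop := by
      rw [← NNReal.tendsto_coe_atTop]
      have h1 : Tendsto a atTop (𝓝[>] 0) :=
        tendsto_nhdsWithin_iff.2 ⟨by rwa [← h0] at ha₀, Eventually.of_forall fun k => (ha k).1⟩
      have h2 := tendsto_atTop_add_const_right atTop (-1) h1.inv_tendsto_nhdsGT_zero
      refine h2.congr fun k => ?_
      have hk := ha k
      rw [Real.coe_toNNReal _ (div_nonneg (by linarith [hk.2]) hk.1.le)]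
      have := hk.1.ne'
      simp only [Pi.inv_apply]
      field_simp
      ring
    simpa using (tendsto_integral_empirical_zero hn hc hC hg0).sub
      (tendsto_integral_gaussianReal_zero hg hC hg0 hinf)
  · have h1 := tendsto_integral_abs_mixDensity_sub hn ha hη hK0 hKη hS hD htail ha₀ hpos hc0 hlim
    have h2 := tendsto_charFun_empirical hn hpos ha1 h1
    have hs : Tendsto (fun k => Real.toNNReal ((1 - a k) / a k)) atTop
        (𝓝 (Real.toNNReal ((1 - a₀) / a₀))) :=
      (continuous_real_toNNReal.tendsto _).comp ((ha₀.const_sub 1).div ha₀ hpos.ne')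
    simpa using (tendsto_integral_empirical hn h2 hg hC).sub
      (tendsto_integral_gaussianReal hg hC hs)

end Sequences

/-! ### The uniform deterministic statement -/

/-- The indices with `c n ≤ i + 1 ≤ (1 - c) n`. -/
noncomputable def middle (c : ℝ) (n : ℕ) : Finset (Fin n) :=
  open Classical in
  {i | c * (n : ℝ) ≤ ((i : ℕ) : ℝ) + 1 ∧ ((i : ℕ) : ℝ) + 1 ≤ (1 - c) * (n : ℝ)}

lemma mem_middle {c : ℝ} {n : ℕ} {i : Fin n} : i ∈ middle c n ↔
    c * (n : ℝ) ≤ ((i : ℕ) : ℝ) + 1 ∧ ((i : ℕ) : ℝ) + 1 ≤ (1 - c) * (n : ℝ) := by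
  simp [middle]

lemma card_compl_middle_div_le {c : ℝ} (hc : 0 ≤ c) {n : ℕ} (hn : 0 < n) :
    ((middle c n)ᶜ.card : ℝ) / n ≤ 2 * c + 2 / n := by
  have hcn : 0 ≤ c * n := by positivity
  set m := ⌈c * n⌉₊ with hm
  -- The two excluded ends; the right one is reflected by `i ↦ n - 1 - i`, so each has at most `⌈c
  -- n⌉` indices.
  have hsub : (middle c n)ᶜ ⊆ (Finset.univ.filter fun i : Fin n => (i : ℕ) < m)
      ∪ (Finset.univ.filter fun i : Fin n => n - 1 - (i : ℕ) < m) := by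
    intro i hi
    rw [Finset.mem_compl, mem_middle, not_and_or, not_le, not_le] at hi
    simp only [Finset.mem_union, Finset.mem_filter, Finset.mem_univ, true_and]
    rcases hi with h | h
    · left
      rw [hm, Nat.lt_ceil]
      linarith
    · right
      rw [hm, Nat.lt_ceil, Nat.sub_sub, Nat.cast_sub (by omega)]
      push_cast
      linarith
  have h1 : (Finset.univ.filter fun i : Fin n => (i : ℕ) < m).card ≤ m := by
    rw [← Finset.card_range m]
    exact Finset.card_le_card_of_injOn (fun i => (i : ℕ)) (fun i hi => by simpa using hi)
      fun i _ j _ h => Fin.ext h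
  have h2 : (Finset.univ.filter fun i : Fin n => n - 1 - (i : ℕ) < m).card ≤ m := by
    rw [← Finset.card_range m]
    refine Finset.card_le_card_of_injOn (fun i => n - 1 - (i : ℕ)) (fun i hi => by simpa using hi)
      fun i _ j _ h => Fin.ext ?_
    have := i.2
    have := j.2
    simp only at h
    omega
  have h3 : (((middle c n)ᶜ.card : ℕ) : ℝ) ≤ 2 * m := by
    have := (Finset.card_le_card hsub).trans (Finset.card_union_le _ _)
    exact_mod_cast (by omega : (middle c n)ᶜ.card ≤ 2 * m)
  have h4 : (m : ℝ) < c * n + 1 := Nat.ceil_lt_add_one hcn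
  have hn' : (0 : ℝ) < n := by exact_mod_cast hn
  rw [div_le_iff₀ hn', add_mul, div_mul_cancel₀ _ hn'.ne']
  nlinarith

/-- If the truncated score of the mixture is small in mean on the middle indices and the mixture
has small tails, then the mixing distribution is close to the normal law `N(0, (1 - a) / a)`. -/
theorem exists_abs_gap_lt {g : ℝ → ℝ} (hg : Continuous g) {C : ℝ} (hC : ∀ x, |g x| ≤ C) {A : ℝ}
    (hA : 0 < A ∨ Tendsto g (cocompact ℝ) (𝓝 0)) {e : ℝ} (he : 0 < e) :
    ∃ δ : ℝ, 0 < δ ∧ ∀ᶠ n : ℕ in atTop, ∀ (v : Fin n → ℝ) (a : ℝ), a ∈ Set.Ioo (0 : ℝ) 1 → A ≤ a →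
      (∫ z, truncScore v a ((Real.log n) ^ 4)⁻¹ (Real.log n) z * mixOn (middle δ n) v z) ≤ δ →
      (∫ z in {z | Real.log n < |z|}, mixDensity v z) ≤ δ →
      |(∫ x, g x ∂(empirical v))
        - ∫ x, g x ∂(gaussianReal 0 (Real.toNNReal ((1 - a) / a)))| < e := by
  -- Failure for every `δ = 1 / (k + 1)` yields a sequence of counterexamples whose trimmed
  -- proportion, score integral and tail all vanish. Taking `n k ≥ k + 3` forces `n k → ∞` and `log
  -- (n k) ≥ 1`.
  by_contra! hcon
  have hδ : ∀ k : ℕ, (0 : ℝ) < 1 / ((k : ℝ) + 1) := fun k => by positivity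
  choose n hn v a ha hAa hD htail hgap using fun k : ℕ =>
    frequently_atTop.1 (hcon (1 / ((k : ℝ) + 1)) (hδ k)) (k + 3)
  have hδ0 : Tendsto (fun k : ℕ => 1 / ((k : ℝ) + 1)) atTop (𝓝 0) :=
    tendsto_one_div_add_atTop_nhds_zero_nat
  have hntop : Tendsto n atTop atTop :=
    tendsto_atTop_mono (fun k => (Nat.le_add_right k 3).trans (hn k)) tendsto_id
  have hnpos : ∀ k, 0 < n k := fun k => by have := hn k; omega
  have hlog1 : ∀ k, 1 ≤ Real.log (n k) := fun k => by
    rw [Real.le_log_iff_exp_le (by exact_mod_cast hnpos k)]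
    have h3 : (3 : ℝ) ≤ n k := by exact_mod_cast (Nat.le_add_left 3 k).trans (hn k)
    exact (Real.exp_one_lt_d9.le.trans (by norm_num)).trans h3
  have hKtop : Tendsto (fun k => Real.log (n k)) atTop atTop :=
    Real.tendsto_log_atTop.comp (tendsto_natCast_atTop_atTop.comp hntop)
  have hcomp : IsCompact (Set.Icc (0 : ℝ) 1 ×ˢ Set.Icc (0 : ℝ) 1) :=
    isCompact_Icc.prod isCompact_Icc
  -- The weight and the density at `0` both lie in `[0, 1]`; these two numbers determine the limit
  -- of the densities.
  obtain ⟨⟨a₀, c⟩, -, ψ, hψ, hlim⟩ := hcomp.tendsto_subseq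
    (x := fun k => (a k, mixDensity (v k) 0)) fun k =>
      ⟨⟨(ha k).1.le, (ha k).2.le⟩, ⟨mixDensity_nonneg _ _, mixDensity_le_one _ _⟩⟩
  have hψtop := hψ.tendsto_atTop
  have ha₀ : Tendsto (fun k => a (ψ k)) atTop (𝓝 a₀) := (continuous_fst.tendsto _).comp hlim
  have hc : Tendsto (fun k => mixDensity (v (ψ k)) 0) atTop (𝓝 c) :=
    (continuous_snd.tendsto _).comp hlim
  have hK := hKtop.comp hψtop
  have hη0 : Tendsto (fun k => ((Real.log (n (ψ k))) ^ 4)⁻¹) atTop (𝓝 0) :=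
    tendsto_inv_atTop_zero.comp ((tendsto_pow_atTop (by norm_num)).comp hK)
  have hKη : Tendsto (fun k => Real.log (n (ψ k)) * ((Real.log (n (ψ k))) ^ 4)⁻¹) atTop
      (𝓝 0) := by
    refine (tendsto_inv_atTop_zero.comp
      ((tendsto_pow_atTop (α := ℝ) (n := 3) (by norm_num)).comp hK)).congr fun k => ?_
    have : Real.log (n (ψ k)) ≠ 0 := (zero_lt_one.trans_le (hlog1 _)).ne'
    simp only [Function.comp]
    field_simp
  have hδψ := hδ0.comp hψtop
  have hS : Tendsto (fun k => ((middle (1 / ((ψ k : ℝ) + 1)) (n (ψ k)))ᶜ.card : ℝ) / n (ψ k))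
      atTop (𝓝 0) := by
    have h1 : Tendsto (fun k => 2 * (1 / ((ψ k : ℝ) + 1)) + 2 / (n (ψ k) : ℝ)) atTop (𝓝 0) := by
      simpa using (hδψ.const_mul 2).add
        ((tendsto_natCast_atTop_atTop.comp (hntop.comp hψtop)).const_div_atTop (2 : ℝ))
    exact squeeze_zero (fun k => by positivity)
      (fun k => card_compl_middle_div_le (hδ _).le (hnpos _)) h1
  have hηpos : ∀ k, 0 < ((Real.log (n (ψ k))) ^ 4)⁻¹ := fun k => by
    have := zero_lt_one.trans_le (hlog1 (ψ k))
    positivity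
  have hfin := tendsto_gap_of_tendsto (n := fun k => n (ψ k)) (v := fun k => v (ψ k))
    (S := fun k => middle (1 / ((ψ k : ℝ) + 1)) (n (ψ k))) (a := fun k => a (ψ k))
    (fun k => hnpos _) (fun k => ha _) hηpos hη0
    (fun k => zero_le_one.trans (hlog1 _)) hK hKη hS
    (squeeze_zero (fun k => integral_nonneg fun z =>
      mul_nonneg (truncScore_nonneg _ (hηpos k) z) (mixOn_nonneg _ _ _)) (fun k => hD _) hδψ)
    (squeeze_zero (fun k => integral_nonneg fun z => mixDensity_nonneg _ _)
      (fun k => htail _) hδψ)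
    ha₀ hc hg hC (hA.imp_left fun h => h.trans_le (ge_of_tendsto' ha₀ fun k => hAa _))
  have h1 := hfin.abs
  rw [abs_zero] at h1
  have h2 := ge_of_tendsto' h1 fun k => hgap (ψ k)
  linarith

/-! ### Lipschitz bounds for the truncated score -/

lemma abs_cutoff_sub_le (K x y : ℝ) : |cutoff K x - cutoff K y| ≤ |x - y| := by
  unfold cutoff
  rw [max_comm 0, max_comm 0]
  refine (abs_max_sub_max_le_abs _ _ _).trans ((abs_min_sub_min_le_max _ _ _ _).trans ?_)
  rw [sub_self, abs_zero, max_eq_right (abs_nonneg _)]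
  calc |K + 1 - |x| - (K + 1 - |y|)| = |(|y| - |x|)| := by congr 1; ring
    _ ≤ |y - x| := abs_abs_sub_abs_le _ _
    _ = |x - y| := abs_sub_comm _ _

lemma abs_cutoff_mul_le {K : ℝ} (hK : 0 ≤ K) (x : ℝ) : |cutoff K x * x| ≤ K + 1 := by
  rcases le_total (K + 1) |x| with h | h
  · rw [cutoff_eq_zero h]; simp; linarith
  · rw [abs_mul, abs_of_nonneg (cutoff_nonneg _ _)]
    exact (mul_le_of_le_one_left (abs_nonneg _) (cutoff_le_one _ _)).trans h

/-- If both points lie outside `[-K - 1, K + 1]` the difference is zero; otherwise one of them is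
bounded by `K + 1`, and the product rule is arranged around that point. -/
lemma abs_cutoff_mul_sub_le {K : ℝ} (hK : 0 ≤ K) (x y : ℝ) :
    |cutoff K x * x - cutoff K y * y| ≤ (K + 2) * |x - y| := by
  have key : ∀ x y : ℝ, |y| ≤ K + 1 →
      |cutoff K x * x - cutoff K y * y| ≤ (K + 2) * |x - y| := by
    intro x y hy
    calc |cutoff K x * x - cutoff K y * y|
        = |(cutoff K x - cutoff K y) * y + cutoff K x * (x - y)| := by congr 1; ring
      _ ≤ |cutoff K x - cutoff K y| * |y| + |cutoff K x| * |x - y| := by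
        rw [← abs_mul, ← abs_mul]; exact abs_add_le _ _
      _ ≤ |x - y| * (K + 1) + 1 * |x - y| := by
        have h1 := abs_cutoff_sub_le K x y
        have h2 : |cutoff K x| ≤ 1 := by
          rw [abs_of_nonneg (cutoff_nonneg _ _)]; exact cutoff_le_one _ _
        gcongr
      _ = _ := by ring
  rcases le_total |y| (K + 1) with h | h
  · exact key x y h
  · rcases le_total |x| (K + 1) with h' | h'
    · rw [abs_sub_comm, abs_sub_comm x y]
      exact key y x h'
    · rw [cutoff_eq_zero h, cutoff_eq_zero h']
      simp only [zero_mul, sub_self, abs_zero]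
      positivity

lemma abs_mul_sub_mul_le (p q p' q' : ℝ) :
    |p * q - p' * q'| ≤ |p - p'| * |q| + |p'| * |q - q'| := by
  rw [← abs_mul, ← abs_mul]
  refine (le_of_eq ?_).trans (abs_add_le _ _)
  congr 1; ring

section Score

variable {n : ℕ} (v : Fin n → ℝ) {a η K : ℝ}

/-- The truncated score with the cutoff moved into the numerator. -/
lemma truncScore_eq (z : ℝ) : truncScore v a η K z
    = |mixSlope v z * cutoff K z + a * (cutoff K z * z * mixDensity v z)|
      / max (mixDensity v z) η := by
  have h : mixSlope v z * cutoff K z + a * (cutoff K z * z * mixDensity v z)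
      = (mixSlope v z + a * z * mixDensity v z) * cutoff K z := by ring
  rw [truncScore, h, abs_mul, abs_of_nonneg (cutoff_nonneg _ _)]
  ring

lemma abs_score_numerator_le (ha : a ∈ Set.Ioo (0 : ℝ) 1) (hK : 0 ≤ K) (z : ℝ) :
    |mixSlope v z * cutoff K z + a * (cutoff K z * z * mixDensity v z)| ≤ K + 2 := by
  refine (abs_add_le _ _).trans ?_
  rw [abs_mul, abs_mul, abs_mul _ (mixDensity v z), abs_of_nonneg (cutoff_nonneg _ _),
    abs_of_nonneg (mixDensity_nonneg _ _), abs_of_pos ha.1]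
  have h1 : |mixSlope v z| * cutoff K z ≤ 1 * 1 := by
    gcongr
    · exact cutoff_nonneg _ _
    · exact abs_mixSlope_le_one v z
    · exact cutoff_le_one _ _
  have h2 : a * (|cutoff K z * z| * mixDensity v z) ≤ 1 * ((K + 1) * 1) := by
    gcongr
    · exact mul_nonneg (abs_nonneg _) (mixDensity_nonneg _ _)
    · exact ha.2.le
    · exact mixDensity_nonneg _ _
    · exact abs_cutoff_mul_le hK z
    · exact mixDensity_le_one _ _
  linarith

lemma truncScore_le (ha : a ∈ Set.Ioo (0 : ℝ) 1) (hη : 0 < η) (hK : 0 ≤ K) (z : ℝ) :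
    truncScore v a η K z ≤ (K + 2) / η := by
  rw [truncScore_eq]
  gcongr
  · exact abs_score_numerator_le v ha hK z
  · exact le_max_right _ _

lemma abs_score_numerator_sub_le (ha : a ∈ Set.Ioo (0 : ℝ) 1) (hK : 0 ≤ K) (x y : ℝ) :
    |(mixSlope v x * cutoff K x + a * (cutoff K x * x * mixDensity v x))
      - (mixSlope v y * cutoff K y + a * (cutoff K y * y * mixDensity v y))|
      ≤ (2 * K + 5) * |x - y| := by
  have h1 : |mixSlope v x * cutoff K x - mixSlope v y * cutoff K y| ≤ 2 * |x - y| := by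
    refine (abs_mul_sub_mul_le _ _ _ _).trans ?_
    have e1 := abs_mixSlope_sub_le v x y
    have e2 : |cutoff K x| ≤ 1 := by
      rw [abs_of_nonneg (cutoff_nonneg _ _)]; exact cutoff_le_one _ _
    have e3 := abs_mixSlope_le_one v y
    have e4 := abs_cutoff_sub_le K x y
    calc _ ≤ |x - y| * 1 + 1 * |x - y| := by gcongr
      _ = _ := by ring
  have h2 : |cutoff K x * x * mixDensity v x - cutoff K y * y * mixDensity v y|
      ≤ (2 * K + 3) * |x - y| := by
    refine (abs_mul_sub_mul_le _ _ _ _).trans ?_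
    have e1 := abs_cutoff_mul_sub_le hK x y
    have e2 : |mixDensity v x| ≤ 1 := by
      rw [abs_of_nonneg (mixDensity_nonneg _ _)]; exact mixDensity_le_one _ _
    have e3 := abs_cutoff_mul_le hK y
    have e4 := abs_mixDensity_sub_le v x y
    calc _ ≤ (K + 2) * |x - y| * 1 + (K + 1) * |x - y| := by gcongr
      _ = _ := by ring
  calc _ = |(mixSlope v x * cutoff K x - mixSlope v y * cutoff K y)
        + a * (cutoff K x * x * mixDensity v x - cutoff K y * y * mixDensity v y)| := by
        congr 1; ring
    _ ≤ |mixSlope v x * cutoff K x - mixSlope v y * cutoff K y|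
        + a * |cutoff K x * x * mixDensity v x - cutoff K y * y * mixDensity v y| := by
        refine (abs_add_le _ _).trans_eq ?_
        rw [abs_mul a, abs_of_pos ha.1]
    _ ≤ 2 * |x - y| + 1 * ((2 * K + 3) * |x - y|) := by
        gcongr
        exact ha.2.le
    _ = _ := by ring

/-- A quotient whose numerator is bounded by `K + 2` and has Lipschitz constant `2 K + 5`, and whose
denominator is `1`-Lipschitz and at least `η`. The constant does not depend on `v`, which is
essential because `v` is random. -/
lemma abs_truncScore_sub_le (ha : a ∈ Set.Ioo (0 : ℝ) 1) (hη : 0 < η) (hK : 0 ≤ K) (x y : ℝ) :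
    |truncScore v a η K x - truncScore v a η K y|
      ≤ ((2 * K + 5) / η + (K + 2) / η ^ 2) * |x - y| := by
  rw [truncScore_eq, truncScore_eq, div_eq_mul_inv, div_eq_mul_inv]
  refine (abs_mul_sub_mul_le _ _ _ _).trans ?_
  set p := mixSlope v x * cutoff K x + a * (cutoff K x * x * mixDensity v x)
  set q := mixSlope v y * cutoff K y + a * (cutoff K y * y * mixDensity v y)
  have hX : η ≤ max (mixDensity v x) η := le_max_right _ _
  have hY : η ≤ max (mixDensity v y) η := le_max_right _ _
  have hX0 := hη.trans_le hX
  have hY0 := hη.trans_le hY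
  have h1 : |(|p| - |q|)| ≤ (2 * K + 5) * |x - y| :=
    (abs_abs_sub_abs_le _ _).trans (abs_score_numerator_sub_le v ha hK x y)
  have h2 : |(max (mixDensity v x) η)⁻¹| ≤ η⁻¹ := by
    rw [abs_of_pos (inv_pos.2 hX0)]; gcongr
  have h3 : |(|q|)| ≤ K + 2 := by rw [abs_abs]; exact abs_score_numerator_le v ha hK y
  have h4 : |(max (mixDensity v x) η)⁻¹ - (max (mixDensity v y) η)⁻¹|
      ≤ |x - y| / η ^ 2 := by
    have h5 : |max (mixDensity v y) η - max (mixDensity v x) η| ≤ |x - y| := by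
      rw [abs_sub_comm]
      exact (abs_max_sub_max_le_abs _ _ _).trans (abs_mixDensity_sub_le v x y)
    rw [inv_sub_inv hX0.ne' hY0.ne', abs_div, abs_of_pos (mul_pos hX0 hY0), pow_two]
    gcongr
  calc _ ≤ (2 * K + 5) * |x - y| * η⁻¹ + (K + 2) * (|x - y| / η ^ 2) := by gcongr
    _ = _ := by ring

end Score

/-! ### Mollification -/

/-- The mean of `w (y + X)`, `X` standard normal. -/
noncomputable def smoothed (w : ℝ → ℝ) (y : ℝ) : ℝ := ∫ x, w (y + x) ∂γ

lemma integrable_shift {w : ℝ → ℝ} (hw : Continuous w) {b : ℝ} (hb : ∀ x, |w x| ≤ b) (y : ℝ) :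
    Integrable (fun x => w (y + x)) γ :=
  Integrable.of_bound (C := b) (by fun_prop) (ae_of_all _ fun x => hb _)

lemma continuous_smoothed {w : ℝ → ℝ} (hw : Continuous w) {b : ℝ} (hb : ∀ x, |w x| ≤ b) :
    Continuous (smoothed w) :=
  continuous_of_dominated (bound := fun _ => b) (fun y => by fun_prop)
    (fun y => ae_of_all _ fun x => hb _) (integrable_const b) (ae_of_all _ fun x => by fun_prop)

lemma abs_smoothed_le {w : ℝ → ℝ} {b : ℝ} (hb : ∀ x, |w x| ≤ b) (y : ℝ) : |smoothed w y| ≤ b := by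
  have := norm_integral_le_of_norm_le_const (μ := γ) (f := fun x => w (y + x))
    (ae_of_all _ fun x => hb _)
  simpa [smoothed] using this

lemma abs_smoothed_sub_le {w : ℝ → ℝ} (hw : Continuous w) {b L : ℝ} (hb : ∀ x, |w x| ≤ b)
    (hL : ∀ x y, |w x - w y| ≤ L * |x - y|) (x y : ℝ) :
    |smoothed w x - smoothed w y| ≤ L * |x - y| := by
  rw [smoothed, smoothed, ← integral_sub (integrable_shift hw hb x) (integrable_shift hw hb y)]
  have := norm_integral_le_of_norm_le_const (μ := γ) (f := fun t => w (x + t) - w (y + t))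
    (C := L * |x - y|) (ae_of_all _ fun t => by simpa using hL (x + t) (y + t))
  simpa using this

/-- Integrating `G` against the mixture is averaging the conditional means of `G` at the residuals.
-/
lemma sum_smoothed_eq {n : ℕ} (S : Finset (Fin n)) (v : Fin n → ℝ) {G : ℝ → ℝ}
    (hG : Continuous G) (hGs : HasCompactSupport G) :
    ∫ z, G z * mixOn S v z = (n : ℝ)⁻¹ * ∑ i ∈ S, smoothed G (v i) := by
  have hφ := continuous_stdPDF
  have hi : ∀ i, Integrable fun z => G z * φ (z - v i) := fun i =>
    (Continuous.mul hG (by fun_prop)).integrable_of_hasCompactSupport hGs.mul_right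
  have h1 : ∀ i, ∫ z, G z * φ (z - v i) = smoothed G (v i) := by
    intro i
    rw [smoothed, integral_stdGaussian,
      ← integral_sub_right_eq_self (fun x => φ x * G (v i + x)) (v i)]
    congr 1 with z
    rw [mul_comm, add_sub_cancel]
  simp_rw [← h1]
  rw [← integral_finsetSum _ fun i _ => hi i, ← integral_const_mul]
  congr 1 with z
  rw [mixOn, ← Finset.mul_sum]
  ring

/-- The normal density with standard deviation `h`. -/
noncomputable def bump (h y : ℝ) : ℝ := h⁻¹ * φ (h⁻¹ * y)

section Bump

variable {h : ℝ}

lemma continuous_bump : Continuous (bump h) := by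
  unfold bump
  have := continuous_stdPDF
  fun_prop

lemma bump_nonneg (hh : 0 < h) (y : ℝ) : 0 ≤ bump h y :=
  mul_nonneg (by positivity) (stdPDF_nonneg _)

lemma abs_bump_le (hh : 0 < h) (y : ℝ) : |bump h y| ≤ h⁻¹ := by
  rw [abs_of_nonneg (bump_nonneg hh y)]
  exact mul_le_of_le_one_right (by positivity) (stdPDF_le_one _)

lemma abs_bump_sub_le (hh : 0 < h) (x y : ℝ) : |bump h x - bump h y| ≤ (h⁻¹) ^ 2 * |x - y| := by
  have hh' : 0 < h⁻¹ := inv_pos.2 hh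
  rw [bump, bump, ← mul_sub, abs_mul, abs_of_pos hh', pow_two, mul_assoc]
  gcongr
  refine (abs_stdPDF_sub_le _ _).trans_eq ?_
  rw [← mul_sub, abs_mul, abs_of_pos hh']

/-- The convolution of `G` with a normal density. -/
noncomputable def mollify (h : ℝ) (G : ℝ → ℝ) (z : ℝ) : ℝ := ∫ t, G t * bump h (z - t)

lemma mollify_eq (hh : 0 < h) (G : ℝ → ℝ) (z : ℝ) :
    mollify h G z = ∫ x, G (z - h * x) ∂γ := by
  rw [mollify, integral_stdGaussian,
    ← integral_sub_left_eq_self (fun t => G t * bump h (z - t)) volume z]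
  have h1 := Measure.integral_comp_mul_left (fun u : ℝ => G (z - u) * φ (h⁻¹ * u)) h
  simp only [inv_mul_cancel_left₀ hh.ne'] at h1
  rw [abs_of_pos (inv_pos.2 hh), smul_eq_mul, ← integral_const_mul] at h1
  simp_rw [sub_sub_cancel, bump, mul_comm (φ _) (G _), h1]
  congr 1 with u
  ring

lemma abs_sub_mollify_le (hh : 0 < h) {G : ℝ → ℝ} (hG : Continuous G) {b L : ℝ}
    (hb : ∀ x, |G x| ≤ b) (hL0 : 0 ≤ L) (hL : ∀ x y, |G x - G y| ≤ L * |x - y|) (z : ℝ) :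
    |G z - mollify h G z| ≤ L * h := by
  have hi : Integrable (fun x => G (z - h * x)) γ :=
    Integrable.of_bound (C := b) (by fun_prop) (ae_of_all _ fun x => hb _)
  have hz : G z = ∫ _, G z ∂γ := by simp
  rw [mollify_eq hh, hz, ← integral_sub (integrable_const _) hi]
  refine abs_integral_le_integral_abs.trans ?_
  calc ∫ x, |G z - G (z - h * x)| ∂γ ≤ ∫ x, L * h * |x| ∂γ := by
        refine integral_mono ((integrable_const _).sub hi).abs
          (integrable_abs_stdGaussian.const_mul _) fun x => (hL _ _).trans_eq ?_
        rw [sub_sub_cancel, abs_mul, abs_of_pos hh, mul_assoc]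
    _ = L * h * ∫ x, |x| ∂γ := integral_const_mul _ _
    _ ≤ L * h := mul_le_of_le_one_right (by positivity) integral_abs_stdGaussian_le

lemma smoothed_mollify (hh : 0 < h) {G : ℝ → ℝ} (hGi : Integrable G) (y : ℝ) :
    smoothed (mollify h G) y = ∫ t, G t * smoothed (bump h) (y - t) := by
  unfold smoothed mollify
  have hbc := continuous_bump (h := h)
  rw [integral_integral_swap]
  · congr 1 with t
    rw [← integral_const_mul]
    congr 1 with x
    congr 2
    ring
  · refine Integrable.mul_bdd (c := h⁻¹) (hGi.comp_snd γ) (Continuous.aestronglyMeasurable ?_)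
      (ae_of_all _ fun p => abs_bump_le hh _)
    fun_prop

/-- Comparison of an empirical mean with its smoothed version, uniformly in the test function. -/
lemma abs_average_sub_integral_le {n : ℕ} (S : Finset (Fin n)) (v z : Fin n → ℝ) (hh : 0 < h)
    {G : ℝ → ℝ} (hG : Continuous G) {b L r : ℝ} (hb : ∀ x, |G x| ≤ b) (hL0 : 0 ≤ L)
    (hL : ∀ x y, |G x - G y| ≤ L * |x - y|) (hr : ∀ x, r < |x| → G x = 0) :
    |(n : ℝ)⁻¹ * ∑ i ∈ S, G (z i) - ∫ t, G t * mixOn S v t|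
      ≤ 2 * (L * h) + b * ∫ t in Set.Icc (-r) r,
        |(n : ℝ)⁻¹ * ∑ i ∈ S, (bump h (z i - t) - smoothed (bump h) (v i - t))| := by
  have hsupp : ∀ t, t ∉ Set.Icc (-r) r → G t = 0 := fun t ht => hr t (by
    rw [Set.mem_Icc, ← abs_le, not_le] at ht; exact ht)
  have hGs : HasCompactSupport G := HasCompactSupport.intro isCompact_Icc hsupp
  have hGi : Integrable G := hG.integrable_of_hasCompactSupport hGs
  have hb0 : 0 ≤ b := (abs_nonneg _).trans (hb 0)
  have hbc := continuous_bump (h := h)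
  have hsc := continuous_smoothed (hbc) (abs_bump_le hh)
  rw [sum_smoothed_eq S v hG hGs]
  have hmc : Continuous (mollify h G) := by
    rw [funext (mollify_eq hh G)]
    exact continuous_of_dominated (bound := fun _ => b) (fun y => by fun_prop)
      (fun y => ae_of_all _ fun x => hb _) (integrable_const b) (ae_of_all _ fun x => by fun_prop)
  have hmb : ∀ x, |mollify h G x| ≤ b := fun x => by
    rw [mollify_eq hh]
    have := norm_integral_le_of_norm_le_const (μ := γ) (f := fun t => G (x - h * t))
      (ae_of_all _ fun t => hb _)
    simpa using this
  -- Replacing `G` by its mollification costs `L h` at the points `z i`, and again at their smoothed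
  -- counterparts.
  have h1 : |(n : ℝ)⁻¹ * ∑ i ∈ S, (G (z i) - mollify h G (z i))| ≤ L * h :=
    abs_average_le S (by positivity) fun i _ => abs_sub_mollify_le hh hG hb hL0 hL _
  have h2 : |(n : ℝ)⁻¹ * ∑ i ∈ S, (smoothed G (v i) - smoothed (mollify h G) (v i))| ≤ L * h := by
    refine abs_average_le S (by positivity) fun i _ => ?_
    rw [smoothed, smoothed, ← integral_sub (integrable_shift hG hb _) (integrable_shift hmc hmb _)]
    have := norm_integral_le_of_norm_le_const (μ := γ)
      (f := fun t => G (v i + t) - mollify h G (v i + t)) (C := L * h)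
      (ae_of_all _ fun t => abs_sub_mollify_le hh hG hb hL0 hL _)
    simpa using this
  have hi1 : ∀ i, Integrable fun t => G t * bump h (z i - t) := fun i =>
    hGi.mul_bdd (c := h⁻¹) (Continuous.aestronglyMeasurable (by fun_prop))
      (ae_of_all _ fun t => abs_bump_le hh _)
  have hi2 : ∀ i, Integrable fun t => G t * smoothed (bump h) (v i - t) := fun i =>
    hGi.mul_bdd (c := h⁻¹) (Continuous.aestronglyMeasurable (by fun_prop))
      (ae_of_all _ fun t => abs_smoothed_le (abs_bump_le hh) _)
  -- After mollification `G` is only a weight in the `t`-integral. It leaves through its sup bound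
  -- `b`, so `G` may itself depend on the points.
  have h3 : (n : ℝ)⁻¹ * ∑ i ∈ S, (mollify h G (z i) - smoothed (mollify h G) (v i))
      = ∫ t, G t * ((n : ℝ)⁻¹ * ∑ i ∈ S,
        (bump h (z i - t) - smoothed (bump h) (v i - t))) := by
    simp_rw [smoothed_mollify hh hGi, mollify, ← integral_sub (hi1 _) (hi2 _)]
    have h0 := integral_finsetSum S fun i _ => (hi1 i).sub (hi2 i)
    simp only [Pi.sub_apply] at h0
    rw [← h0, ← integral_const_mul]
    congr 1 with t
    simp_rw [← mul_sub, ← Finset.mul_sum]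
    ring
  set m : ℝ → ℝ := fun t => (n : ℝ)⁻¹ * ∑ i ∈ S,
    (bump h (z i - t) - smoothed (bump h) (v i - t)) with hm
  have hmcont : Continuous m := by
    simp only [hm]
    fun_prop
  have h4 : |∫ t, G t * m t| ≤ b * ∫ t in Set.Icc (-r) r, |m t| := by
    have h5 : ∫ t, G t * m t = ∫ t in Set.Icc (-r) r, G t * m t :=
      (setIntegral_eq_integral_of_forall_compl_eq_zero fun t ht => by
        rw [hsupp t ht, zero_mul]).symm
    rw [h5, ← integral_const_mul]
    refine abs_integral_le_integral_abs.trans ?_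
    refine setIntegral_mono_on (Continuous.integrableOn_Icc (by fun_prop))
      (Continuous.integrableOn_Icc (by fun_prop)) measurableSet_Icc fun t _ => ?_
    rw [abs_mul]
    gcongr
    exact hb t
  have h6 : (n : ℝ)⁻¹ * ∑ i ∈ S, G (z i) - (n : ℝ)⁻¹ * ∑ i ∈ S, smoothed G (v i)
      = (n : ℝ)⁻¹ * ∑ i ∈ S, (G (z i) - mollify h G (z i))
        - (n : ℝ)⁻¹ * ∑ i ∈ S, (smoothed G (v i) - smoothed (mollify h G) (v i))
        + ∫ t, G t * m t := by
    rw [← h3]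
    simp only [Finset.sum_sub_distrib]
    ring
  rw [h6]
  refine (abs_add_le _ _).trans (add_le_add ((abs_sub _ _).trans ?_) h4)
  linarith

end Bump

/-! ### Resampling one coordinate -/

section Resampling

lemma measurable_update_prod {ι : Type*} [DecidableEq ι] (j : ι) :
    Measurable fun p : (ι → ℝ) × ℝ => Function.update p.1 j p.2 := by
  refine measurable_pi_lambda _ fun i => ?_
  by_cases h : i = j
  · subst h
    simpa using measurable_snd
  · simp only [Function.update_of_ne h]
    fun_prop

variable {ι : Type*} [Fintype ι] [DecidableEq ι]

/-- Redrawing one coordinate independently preserves a product law. This stands in for conditioning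
on all the other coordinates. -/
lemma measurePreserving_update (κ : Measure ℝ) [IsProbabilityMeasure κ] (j : ι) :
    MeasurePreserving (fun p : (ι → ℝ) × ℝ => Function.update p.1 j p.2)
      ((Measure.pi fun _ => κ).prod κ) (Measure.pi fun _ => κ) := by
  refine ⟨measurable_update_prod j, (Measure.pi_eq fun s hs => ?_).symm⟩
  rw [Measure.map_apply (measurable_update_prod j) (MeasurableSet.univ_pi hs)]
  have : (fun p : (ι → ℝ) × ℝ => Function.update p.1 j p.2) ⁻¹' Set.univ.pi s
      = (Set.univ.pi (Function.update s j Set.univ)) ×ˢ s j := by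
    ext ⟨e, x⟩
    simp only [Set.mem_preimage, Set.mem_pi, Set.mem_univ, true_imp_iff, Set.mem_prod]
    constructor
    · intro h
      refine ⟨fun i => ?_, by simpa using h j⟩
      by_cases hi : i = j
      · subst hi; simp
      · simpa [Function.update_of_ne hi] using h i
    · rintro ⟨h, hx⟩ i
      by_cases hi : i = j
      · subst hi; simpa using hx
      · simpa [Function.update_of_ne hi] using h i
  rw [this, Measure.prod_prod, Measure.pi_pi, ← Finset.mul_prod_erase _ _ (Finset.mem_univ j),
    ← Finset.mul_prod_erase Finset.univ (fun i => κ (s i)) (Finset.mem_univ j)]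
  simp only [Function.update_self, measure_univ, one_mul]
  rw [mul_comm]
  congr 1
  refine Finset.prod_congr rfl fun i hi => ?_
  rw [Function.update_of_ne (Finset.ne_of_mem_erase hi)]

lemma lintegral_update (κ : Measure ℝ) [IsProbabilityMeasure κ] (j : ι) {F : (ι → ℝ) → ℝ≥0∞}
    (hF : Measurable F) :
    ∫⁻ e, F e ∂(Measure.pi fun _ => κ)
      = ∫⁻ e, ∫⁻ x, F (Function.update e j x) ∂κ ∂(Measure.pi fun _ => κ) := by
  rw [← (measurePreserving_update κ j).lintegral_comp hF, lintegral_prod]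
  exact (hF.comp (measurable_update_prod j)).aemeasurable

lemma integral_update (κ : Measure ℝ) [IsProbabilityMeasure κ] (j : ι) {F : (ι → ℝ) → ℝ}
    (hF : Integrable F (Measure.pi fun _ => κ)) :
    ∫ e, F e ∂(Measure.pi fun _ => κ)
      = ∫ e, ∫ x, F (Function.update e j x) ∂κ ∂(Measure.pi fun _ => κ) := by
  have hmp := measurePreserving_update (ι := ι) κ j
  have h1 : ∫ e, F e ∂(Measure.pi fun _ : ι => κ)
      = ∫ p, F (Function.update p.1 j p.2) ∂((Measure.pi fun _ : ι => κ).prod κ) := by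
    conv_lhs => rw [← hmp.map_eq]
    rw [integral_map hmp.measurable.aemeasurable (by rw [hmp.map_eq]; exact hF.1)]
  rw [h1, integral_prod]
  exact (hmp.integrable_comp hF.1).2 hF

end Resampling

/-! ### A variance bound for smoothed residual averages -/

section Variance

variable {n : ℕ} {V : Fin n → (Fin n → ℝ) → ℝ} {w : ℝ → ℝ} {b L : ℝ} {r : Fin n → Fin n → ℝ}

/-- The conditionally centred value of `w` at the residual `V i + e i`. -/
noncomputable def fluct (w : ℝ → ℝ) (V : Fin n → (Fin n → ℝ) → ℝ) (i : Fin n) (e : Fin n → ℝ) : ℝ :=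
  w (V i e + e i) - smoothed w (V i e)

lemma measurable_fluct (hw : Continuous w) (hb : ∀ x, |w x| ≤ b) (hV : ∀ i, Measurable (V i))
    (i : Fin n) : Measurable (fluct w V i) :=
  (hw.measurable.comp ((hV i).add (measurable_pi_apply i))).sub
    ((continuous_smoothed hw hb).measurable.comp (hV i))

lemma abs_fluct_le (hb : ∀ x, |w x| ≤ b) (i : Fin n) (e : Fin n → ℝ) :
    |fluct w V i e| ≤ 2 * b := by
  refine (abs_sub _ _).trans ?_
  linarith [hb (V i e + e i), abs_smoothed_le hb (V i e)]

/-- With the other coordinates fixed, `V j` and `H` are constant in `e j`, and redrawing `e j`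
averages `w (V j + e j)` to `smoothed w (V j)`. -/
lemma integral_mul_fluct_eq_zero (hw : Continuous w) (hb : ∀ x, |w x| ≤ b)
    (hV : ∀ i, Measurable (V i)) (hVi : ∀ i e x, V i (Function.update e i x) = V i e)
    (j : Fin n) {H : (Fin n → ℝ) → ℝ} (hH : Measurable H) {c : ℝ} (hHc : ∀ e, |H e| ≤ c)
    (hHj : ∀ e x, H (Function.update e j x) = H e) :
    ∫ e, H e * fluct w V j e ∂(Measure.pi fun _ => γ) = 0 := by
  rw [integral_update γ j]
  · refine integral_eq_zero_of_ae (ae_of_all _ fun e => ?_)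
    simp only [hHj, fluct, hVi, Function.update_self, Pi.zero_apply]
    rw [integral_const_mul, integral_sub (integrable_shift hw hb _) (integrable_const _)]
    simp [smoothed]
  · refine Integrable.of_bound (C := c * (2 * b))
      (hH.mul (measurable_fluct hw hb hV j)).aestronglyMeasurable (ae_of_all _ fun e => ?_)
    rw [norm_mul]
    have h1 := hHc e
    have h2 := abs_fluct_le (V := V) hb j e
    exact mul_le_mul h1 h2 (abs_nonneg _) ((abs_nonneg _).trans h1)

/-- Setting `e j` to `0` inside the `i`-th fluctuation makes it orthogonal to the `j`-th. The
replacement changes it by at most `2 L r i j |e j|`, the other factor is at most `2 b`, and `E |e j|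
≤ 1`. -/
lemma abs_integral_fluct_mul_le (hw : Continuous w) (hb : ∀ x, |w x| ≤ b) (hL0 : 0 ≤ L)
    (hL : ∀ x y, |w x - w y| ≤ L * |x - y|)
    (hV : ∀ i, Measurable (V i)) (hVi : ∀ i e x, V i (Function.update e i x) = V i e)
    (hr : ∀ i j, j ≠ i → ∀ e, |V i (Function.update e j 0) - V i e| ≤ r i j * |e j|)
    (hr0 : ∀ i j, 0 ≤ r i j) {i j : Fin n} (hij : j ≠ i) :
    |∫ e, fluct w V i e * fluct w V j e ∂(Measure.pi fun _ => γ)| ≤ 4 * b * L * r i j := by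
  have hb0 : 0 ≤ b := (abs_nonneg _).trans (hb 0)
  set H : (Fin n → ℝ) → ℝ := fun e => fluct w V i (Function.update e j 0) with hH
  have hHm : Measurable H := (measurable_fluct hw hb hV i).comp
    ((measurable_update_prod j).comp (measurable_id.prodMk measurable_const))
  have hfm := measurable_fluct hw hb hV
  have hzero : ∫ e, H e * fluct w V j e ∂(Measure.pi fun _ => γ) = 0 :=
    integral_mul_fluct_eq_zero hw hb hV hVi j hHm (fun e => abs_fluct_le hb i _)
      fun e x => by simp [hH]
  have hbdd : ∀ {H' : (Fin n → ℝ) → ℝ}, Measurable H' → (∀ e, |H' e| ≤ 2 * b) →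
      Integrable (fun e => H' e * fluct w V j e) (Measure.pi fun _ => γ) := fun {H'} h1 h2 => by
    refine Integrable.of_bound (C := 2 * b * (2 * b)) (h1.mul (hfm j)).aestronglyMeasurable
      (ae_of_all _ fun e => ?_)
    rw [norm_mul]
    exact mul_le_mul (h2 e) (abs_fluct_le hb j e) (abs_nonneg _) (by positivity)
  have hsub : ∫ e, fluct w V i e * fluct w V j e ∂(Measure.pi fun _ => γ)
      = ∫ e, (fluct w V i e - H e) * fluct w V j e ∂(Measure.pi fun _ => γ) := by
    simp_rw [sub_mul]
    rw [integral_sub (hbdd (hfm i) (abs_fluct_le hb i)) (hbdd hHm fun e => abs_fluct_le hb i _),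
      hzero, sub_zero]
  have hpt : ∀ e, |(fluct w V i e - H e) * fluct w V j e| ≤ 4 * b * L * r i j * |e j| := by
    intro e
    have h1 : |fluct w V i e - H e| ≤ 2 * L * (r i j * |e j|) := by
      have hVe : |V i e - V i (Function.update e j 0)| ≤ r i j * |e j| := by
        rw [abs_sub_comm]; exact hr i j hij e
      have e1 : |w (V i e + e i) - w (V i (Function.update e j 0) + e i)|
          ≤ L * (r i j * |e j|) := by
        refine (hL _ _).trans ?_
        rw [add_sub_add_right_eq_sub]
        gcongr
      have e2 : |smoothed w (V i e) - smoothed w (V i (Function.update e j 0))|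
          ≤ L * (r i j * |e j|) := by
        refine (abs_smoothed_sub_le hw hb hL _ _).trans ?_
        gcongr
      simp only [hH, fluct, Function.update_of_ne hij.symm]
      calc _ = |(w (V i e + e i) - w (V i (Function.update e j 0) + e i))
            - (smoothed w (V i e) - smoothed w (V i (Function.update e j 0)))| := by
            congr 1; ring
        _ ≤ _ := (abs_sub _ _).trans (by linarith)
    rw [abs_mul]
    calc _ ≤ 2 * L * (r i j * |e j|) * (2 * b) := by
          have := hr0 i j
          have h2 := abs_fluct_le (V := V) hb j e
          gcongr
      _ = _ := by ring
  have hmp := measurePreserving_eval (fun _ : Fin n => γ) j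
  have habs : Integrable (fun e : Fin n → ℝ => |e j|) (Measure.pi fun _ => γ) :=
    (hmp.integrable_comp integrable_abs_stdGaussian.1).2 integrable_abs_stdGaussian
  have habs1 : ∫ e : Fin n → ℝ, |e j| ∂(Measure.pi fun _ => γ) ≤ 1 := by
    have h1 : ∫ e : Fin n → ℝ, |e j| ∂(Measure.pi fun _ => γ) = ∫ x : ℝ, |x| ∂γ := by
      conv_rhs => rw [← hmp.map_eq]
      rw [integral_map hmp.measurable.aemeasurable (by fun_prop)]
    rw [h1]; exact integral_abs_stdGaussian_le
  rw [hsub]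
  refine abs_integral_le_integral_abs.trans ?_
  calc _ ≤ ∫ e : Fin n → ℝ, 4 * b * L * r i j * |e j| ∂(Measure.pi fun _ => γ) :=
        integral_mono_of_nonneg (ae_of_all _ fun e => abs_nonneg _) (habs.const_mul _)
          (ae_of_all _ hpt)
    _ = 4 * b * L * r i j * ∫ e : Fin n → ℝ, |e j| ∂(Measure.pi fun _ => γ) :=
        integral_const_mul _ _
    _ ≤ _ := mul_le_of_le_one_right (by have := hr0 i j; positivity) habs1

/-- Expand the square: each diagonal term is at most `4 b²`, and each row of covariances sums to at
most `4 b L T`. The bound is linear in `n` rather than quadratic. -/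
lemma integral_sq_sum_fluct_le (S : Finset (Fin n)) (hw : Continuous w) (hb : ∀ x, |w x| ≤ b)
    (hL0 : 0 ≤ L) (hL : ∀ x y, |w x - w y| ≤ L * |x - y|)
    (hV : ∀ i, Measurable (V i)) (hVi : ∀ i e x, V i (Function.update e i x) = V i e)
    (hr : ∀ i j, j ≠ i → ∀ e, |V i (Function.update e j 0) - V i e| ≤ r i j * |e j|)
    (hr0 : ∀ i j, 0 ≤ r i j) {T : ℝ} (hT : ∀ i, ∑ j ∈ Finset.univ.erase i, r i j ≤ T) :
    ∫ e, (∑ i ∈ S, fluct w V i e) ^ 2 ∂(Measure.pi fun _ => γ)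
      ≤ n * (4 * b ^ 2 + 4 * b * L * T) := by
  have hb0 : 0 ≤ b := (abs_nonneg _).trans (hb 0)
  have hfm := measurable_fluct hw hb hV
  have hbdd : ∀ i j, Integrable (fun e => fluct w V i e * fluct w V j e)
      (Measure.pi fun _ => γ) := fun i j => by
    refine Integrable.of_bound (C := 2 * b * (2 * b)) ((hfm i).mul (hfm j)).aestronglyMeasurable
      (ae_of_all _ fun e => ?_)
    rw [norm_mul]
    exact mul_le_mul (abs_fluct_le hb i e) (abs_fluct_le hb j e) (abs_nonneg _) (by positivity)
  simp_rw [pow_two (∑ i ∈ S, _), Finset.sum_mul_sum]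
  rw [integral_finsetSum _ fun i _ => integrable_finsetSum _ fun j _ => hbdd i j]
  have hrow : ∀ i ∈ S, ∫ e, ∑ j ∈ S, fluct w V i e * fluct w V j e ∂(Measure.pi fun _ => γ)
      ≤ 4 * b ^ 2 + 4 * b * L * T := by
    intro i hi
    rw [integral_finsetSum _ fun j _ => hbdd i j, ← Finset.add_sum_erase S _ hi]
    have hdiag : ∫ e, fluct w V i e * fluct w V i e ∂(Measure.pi fun _ => γ) ≤ 4 * b ^ 2 := by
      have := norm_integral_le_of_norm_le_const (μ := Measure.pi fun _ : Fin n => γ)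
        (f := fun e => fluct w V i e * fluct w V i e) (C := 2 * b * (2 * b))
        (ae_of_all _ fun e => by
          rw [norm_mul]
          exact mul_le_mul (abs_fluct_le hb i e) (abs_fluct_le hb i e) (abs_nonneg _)
            (by positivity))
      simp only [probReal_univ, mul_one] at this
      exact (le_abs_self _).trans (this.trans_eq (by ring))
    have hoff : ∑ j ∈ S.erase i, ∫ e, fluct w V i e * fluct w V j e ∂(Measure.pi fun _ => γ)
        ≤ 4 * b * L * T := by
      calc _ ≤ ∑ j ∈ S.erase i, 4 * b * L * r i j := Finset.sum_le_sum fun j hj =>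
            (le_abs_self _).trans (abs_integral_fluct_mul_le hw hb hL0 hL hV hVi hr hr0
              (Finset.ne_of_mem_erase hj))
        _ ≤ ∑ j ∈ Finset.univ.erase i, 4 * b * L * r i j :=
            Finset.sum_le_sum_of_subset_of_nonneg
              (Finset.erase_subset_erase i (Finset.subset_univ S))
              fun j _ _ => by have := hr0 i j; positivity
        _ = 4 * b * L * ∑ j ∈ Finset.univ.erase i, r i j := by rw [Finset.mul_sum]
        _ ≤ _ := by
          have := hT i
          gcongr
    linarith
  have hT0 : 0 ≤ n * (4 * b ^ 2 + 4 * b * L * T) := by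
    rcases Nat.eq_zero_or_pos n with h0 | h0
    · subst h0; simp
    · have : 0 ≤ T := (Finset.sum_nonneg fun j _ => hr0 ⟨0, h0⟩ j).trans (hT ⟨0, h0⟩)
      positivity
  refine (Finset.sum_le_card_nsmul _ _ _ hrow).trans ?_
  rw [nsmul_eq_mul]
  rcases Nat.eq_zero_or_pos n with h0 | h0
  · subst h0
    have : S = ∅ := Finset.eq_empty_of_isEmpty S
    simp [this]
  · have : 0 ≤ T := (Finset.sum_nonneg fun j _ => hr0 ⟨0, h0⟩ j).trans (hT ⟨0, h0⟩)
    gcongr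
    exact (Finset.card_le_univ S).trans_eq (Fintype.card_fin n)

end Variance

/-! ### The Lipschitz constants of a local predictor -/

/-- Each distance from `i` occurs at most once on either side. -/
lemma sum_erase_dist_le {f : ℕ → ℝ} (hf0 : ∀ M, 0 ≤ f M) (hf : Summable f) {n : ℕ} (i : Fin n) :
    ∑ j ∈ Finset.univ.erase i, f (Nat.dist i j) ≤ 2 * ∑' M, f M := by
  have hsub : (Finset.univ.erase i : Finset (Fin n))
      ⊆ Finset.univ.filter (fun j => j < i) ∪ Finset.univ.filter (fun j => i < j) := by
    intro j hj
    simpa using lt_or_gt_of_ne (Finset.ne_of_mem_erase hj)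
  have hinj : ∀ s : Finset (Fin n), Set.InjOn (fun j : Fin n => Nat.dist i j) s →
      ∑ j ∈ s, f (Nat.dist i j) ≤ ∑' M, f M := by
    intro s hs
    rw [← Finset.sum_image (f := f) hs]
    exact hf.sum_le_tsum _ fun M _ => hf0 M
  refine (Finset.sum_le_sum_of_subset_of_nonneg hsub fun _ _ _ => hf0 _).trans ?_
  rw [Finset.sum_union (Finset.disjoint_filter.2 fun j _ h1 h2 => lt_asymm h1 h2), two_mul]
  refine add_le_add (hinj _ ?_) (hinj _ ?_) <;>
  · intro j hj k hk hjk
    simp only [Finset.coe_filter, Finset.mem_univ, true_and, Set.mem_ofPred_eq, Fin.lt_def]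
      at hj hk
    simp only [Nat.dist] at hjk
    exact Fin.ext (by omega)

/-- Eventually `ρ M < 1 / M²`. The positive part is taken because `ρ` is not assumed nonnegative. -/
lemma IsLocalPredictor.summable_posPart {mt : ∀ n, Fin n → (Fin n → ℝ) → ℝ} {ρ : ℕ → ℝ}
    (h : IsLocalPredictor mt ρ) : Summable fun M => max (ρ M) 0 := by
  have hev := eventually_lt_of_limsup_lt h.limsup_lt
  have hs : Summable fun M : ℕ => 1 / (M : ℝ) ^ 2 := Real.summable_one_div_nat_pow.2 one_lt_two
  refine hs.of_norm_bounded_eventually_nat ?_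
  filter_upwards [hev, eventually_gt_atTop 0] with M hM hM0
  have hM1 : (M : ℝ) ^ 2 * ρ M < 1 := by exact_mod_cast hM
  have hM2 : (0 : ℝ) < (M : ℝ) ^ 2 := by positivity
  rw [Real.norm_eq_abs, abs_of_nonneg (le_max_right _ _)]
  refine max_le ?_ (by positivity)
  rw [le_div_iff₀ hM2]
  linarith

/-! ### Moment bounds in the signal plus noise model -/

section Pointwise

variable {Ω : Type*} {n : ℕ} {μ ε : Fin n → Ω → ℝ} {mt : Fin n → (Fin n → ℝ) → ℝ}

lemma resid_eq (ω : Ω) (i : Fin n) : resid μ ε mt ω i = centred μ ε mt ω i + ε i ω := by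
  simp only [resid, centred, obs]; ring

/-- The centred signal as a function of the signal and the noise. -/
def centredOf (mt : Fin n → (Fin n → ℝ) → ℝ) (m : Fin n → ℝ) (i : Fin n) (e : Fin n → ℝ) : ℝ :=
  m i - mt i (m + e)

lemma centred_eq (ω : Ω) (i : Fin n) :
    centred μ ε mt ω i = centredOf mt (fun i => μ i ω) i (fun i => ε i ω) := rfl

end Pointwise

section Model

variable {Ω : Type*} [MeasurableSpace Ω] {P : Measure Ω} {n : ℕ}
  {μ ε : Fin n → Ω → ℝ} {mt : Fin n → (Fin n → ℝ) → ℝ}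

/-- By independence the signal can be frozen while the noise is integrated against the product
normal law, to which the variance bound applies. -/
lemma IsSignalPlusNoise.lintegral_eq [IsProbabilityMeasure P] (hm : IsSignalPlusNoise P μ ε)
    {F : (Fin n → ℝ) × (Fin n → ℝ) → ℝ≥0∞} (hF : Measurable F) :
    ∫⁻ ω, F (fun i => μ i ω, fun i => ε i ω) ∂P
      = ∫⁻ m, ∫⁻ e, F (m, e) ∂(Measure.pi fun _ => γ) ∂(P.map fun ω i => μ i ω) := by
  have hμ : Measurable fun ω i => μ i ω := measurable_pi_lambda _ hm.measurable_signal
  have hε : Measurable fun ω i => ε i ω := measurable_pi_lambda _ hm.measurable_noise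
  have h1 := (indepFun_iff_map_prod_eq_prod_map_map hμ.aemeasurable hε.aemeasurable).1 hm.indep
  have h2 := (iIndepFun_iff_map_fun_eq_pi_map
    fun i => (hm.measurable_noise i).aemeasurable).1 hm.noise_indep
  simp_rw [hm.noise_gaussian] at h2
  rw [h2] at h1
  rw [← lintegral_prod _ hF.aemeasurable, ← h1, lintegral_map hF (hμ.prodMk hε)]

lemma measurable_obs (hm : IsSignalPlusNoise P μ ε) : Measurable fun ω => obs μ ε ω :=
  measurable_pi_lambda _ fun i => (hm.measurable_signal i).add (hm.measurable_noise i)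

lemma measurable_centred (hm : IsSignalPlusNoise P μ ε) (hmt : ∀ i, Measurable (mt i)) :
    Measurable fun ω => centred μ ε mt ω :=
  measurable_pi_lambda _ fun i =>
    (hm.measurable_signal i).sub ((hmt i).comp (measurable_obs hm))

lemma measurable_resid (hm : IsSignalPlusNoise P μ ε) (hmt : ∀ i, Measurable (mt i)) :
    Measurable fun ω => resid μ ε mt ω :=
  measurable_pi_lambda _ fun i =>
    ((measurable_pi_apply i).comp (measurable_obs hm)).sub ((hmt i).comp (measurable_obs hm))

variable [IsProbabilityMeasure P]

lemma measurable_centredOf (hmt : ∀ i, Measurable (mt i)) (i : Fin n) :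
    Measurable fun p : (Fin n → ℝ) × (Fin n → ℝ) => centredOf mt p.1 i p.2 :=
  ((measurable_pi_apply i).comp measurable_fst).sub
    ((hmt i).comp (measurable_fst.add measurable_snd))

lemma centredOf_update_self (hdep : ∀ i, DependsOn (mt i) {j | j ≠ i}) (m : Fin n → ℝ) (i : Fin n)
    (e : Fin n → ℝ) (x : ℝ) : centredOf mt m i (Function.update e i x) = centredOf mt m i e := by
  simp only [centredOf]
  congr 1
  refine hdep i fun j hj => ?_
  simp only [Pi.add_apply]
  rw [Function.update_of_ne hj]

lemma abs_centredOf_update_sub_le {ρ : ℕ → ℝ}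
    (hlip : ∀ i j : Fin n, j ≠ i → ∀ (y : Fin n → ℝ) (d : ℝ),
      |mt i (Function.update y j (y j + d)) - mt i y| ≤ ρ (Nat.dist i j) * |d|)
    (m : Fin n → ℝ) (i j : Fin n) (hij : j ≠ i) (e : Fin n → ℝ) :
    |centredOf mt m i (Function.update e j 0) - centredOf mt m i e|
      ≤ max (ρ (Nat.dist i j)) 0 * |e j| := by
  -- Deleting the noise `e j` is the shift of `Y j` by `-e j`, to which the Lipschitz hypothesis
  -- applies.
  have h1 : m + Function.update e j 0 = Function.update (m + e) j ((m + e) j + -e j) := by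
    ext k
    by_cases hk : k = j
    · subst hk; simp
    · simp [Function.update_of_ne hk]
  rw [centredOf, centredOf, sub_sub_sub_cancel_left, abs_sub_comm, h1]
  refine (hlip i j hij (m + e) (-e j)).trans ?_
  rw [abs_neg]
  gcongr
  exact le_max_left _ _

/-- The second moment of a centred average over the residuals is `O(1 / n)`. -/
lemma lintegral_sq_average_le (hm : IsSignalPlusNoise P μ ε) (hmt : ∀ i, Measurable (mt i))
    (hdep : ∀ i, DependsOn (mt i) {j | j ≠ i}) {ρ : ℕ → ℝ}
    (hlip : ∀ i j : Fin n, j ≠ i → ∀ (y : Fin n → ℝ) (d : ℝ),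
      |mt i (Function.update y j (y j + d)) - mt i y| ≤ ρ (Nat.dist i j) * |d|)
    (hρ : Summable fun M => max (ρ M) 0) (S : Finset (Fin n)) {w : ℝ → ℝ} {b L : ℝ}
    (hw : Continuous w) (hb : ∀ x, |w x| ≤ b) (hL0 : 0 ≤ L)
    (hL : ∀ x y, |w x - w y| ≤ L * |x - y|) :
    ∫⁻ ω, ENNReal.ofReal (((n : ℝ)⁻¹ * ∑ i ∈ S,
        (w (resid μ ε mt ω i) - smoothed w (centred μ ε mt ω i))) ^ 2) ∂P
      ≤ ENNReal.ofReal ((4 * b ^ 2 + 4 * b * L * (2 * ∑' M, max (ρ M) 0)) / n) := by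
  set F : (Fin n → ℝ) × (Fin n → ℝ) → ℝ := fun p =>
    ((n : ℝ)⁻¹ * ∑ i ∈ S, fluct w (centredOf mt p.1) i p.2) ^ 2 with hF
  have hFm : Measurable F := by
    refine Measurable.pow_const (Measurable.const_mul (Finset.measurable_sum _ fun i _ => ?_) _) 2
    exact (hw.measurable.comp ((measurable_centredOf hmt i).add
      ((measurable_pi_apply i).comp measurable_snd))).sub
      ((continuous_smoothed hw hb).measurable.comp (measurable_centredOf hmt i))
  have h1 : ∀ ω, ((n : ℝ)⁻¹ * ∑ i ∈ S,
      (w (resid μ ε mt ω i) - smoothed w (centred μ ε mt ω i))) ^ 2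
      = F (fun i => μ i ω, fun i => ε i ω) := by
    intro ω
    simp only [hF, fluct, resid_eq, centred_eq]
  simp_rw [h1]
  have hμ : Measurable fun ω i => μ i ω := measurable_pi_lambda _ hm.measurable_signal
  have := Measure.isProbabilityMeasure_map (μ := P) hμ.aemeasurable
  rw [hm.lintegral_eq (F := fun p => ENNReal.ofReal (F p)) hFm.ennreal_ofReal]
  refine (lintegral_mono fun m => ?_).trans_eq (by rw [lintegral_const, measure_univ, mul_one])
  have hV : ∀ i, Measurable (centredOf mt m i) := fun i =>
    (measurable_centredOf hmt i).comp (measurable_const.prodMk measurable_id)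
  have hint : Integrable (fun e => F (m, e)) (Measure.pi fun _ => γ) := by
    refine Integrable.of_bound (C := (2 * b) ^ 2)
      (hFm.comp (measurable_const.prodMk measurable_id)).aestronglyMeasurable
      (ae_of_all _ fun e => ?_)
    have hb0 : 0 ≤ b := (abs_nonneg _).trans (hb 0)
    simp only [hF]
    rw [norm_pow, Real.norm_eq_abs]
    gcongr
    exact abs_average_le S (by positivity) fun i _ => abs_fluct_le hb i e
  rw [← ofReal_integral_eq_lintegral_ofReal hint (ae_of_all _ fun e => sq_nonneg _)]
  apply ENNReal.ofReal_le_ofReal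
  simp only [hF, mul_pow]
  rw [integral_const_mul]
  have hvar := integral_sq_sum_fluct_le S (V := centredOf mt m)
    (r := fun i j => max (ρ (Nat.dist i j)) 0) hw hb hL0 hL hV
    (centredOf_update_self hdep m) (abs_centredOf_update_sub_le hlip m)
    (fun i j => le_max_right _ _)
    (sum_erase_dist_le (f := fun M => max (ρ M) 0) (fun M => le_max_right _ _) hρ)
  refine (mul_le_mul_of_nonneg_left hvar (by positivity)).trans_eq ?_
  rcases Nat.eq_zero_or_pos n with h0 | h0
  · subst h0; simp
  · have : (n : ℝ) ≠ 0 := by exact_mod_cast h0.ne'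
    field_simp

/-- The mean of the integrated discrepancy between the kernel density estimate from the residuals
and its smoothed version. -/
lemma lintegral_kernel_discrepancy_le (hm : IsSignalPlusNoise P μ ε) (hmt : ∀ i, Measurable (mt i))
    (hdep : ∀ i, DependsOn (mt i) {j | j ≠ i}) {ρ : ℕ → ℝ}
    (hlip : ∀ i j : Fin n, j ≠ i → ∀ (y : Fin n → ℝ) (d : ℝ),
      |mt i (Function.update y j (y j + d)) - mt i y| ≤ ρ (Nat.dist i j) * |d|)
    (hρ : Summable fun M => max (ρ M) 0) (S : Finset (Fin n)) {h r s : ℝ} (hh : 0 < h)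
    (hs : 0 < s) :
    ∫⁻ ω, ENNReal.ofReal (∫ t in Set.Icc (-r) r, |(n : ℝ)⁻¹ * ∑ i ∈ S,
        (bump h (resid μ ε mt ω i - t) - smoothed (bump h) (centred μ ε mt ω i - t))|) ∂P
      ≤ ENNReal.ofReal (2 * r * (s + s⁻¹ *
        ((4 * (h⁻¹) ^ 2 + 4 * h⁻¹ * (h⁻¹) ^ 2 * (2 * ∑' M, max (ρ M) 0)) / n))) := by
  set Q : ℝ := (4 * (h⁻¹) ^ 2 + 4 * h⁻¹ * (h⁻¹) ^ 2 * (2 * ∑' M, max (ρ M) 0)) / n with hQ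
  have hQ0 : 0 ≤ Q := by
    have : 0 ≤ ∑' M, max (ρ M) 0 := tsum_nonneg fun M => le_max_right _ _
    positivity
  set m : Ω → ℝ → ℝ := fun ω t => (n : ℝ)⁻¹ * ∑ i ∈ S,
    (bump h (resid μ ε mt ω i - t) - smoothed (bump h) (centred μ ε mt ω i - t)) with hmdef
  have hbc := continuous_bump (h := h)
  have hsc := continuous_smoothed hbc (abs_bump_le hh)
  have hmcont : ∀ ω, Continuous (m ω) := fun ω => by
    simp only [hmdef]; fun_prop
  have hjoint : Measurable fun p : Ω × ℝ => m p.1 p.2 := by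
    refine Measurable.const_mul (Finset.measurable_sum _ fun i _ => ?_) _
    have h1 : Measurable fun p : Ω × ℝ => resid μ ε mt p.1 i - p.2 :=
      (((measurable_pi_apply i).comp (measurable_resid hm hmt)).comp measurable_fst).sub
        measurable_snd
    have h2 : Measurable fun p : Ω × ℝ => centred μ ε mt p.1 i - p.2 :=
      (((measurable_pi_apply i).comp (measurable_centred hm hmt)).comp measurable_fst).sub
        measurable_snd
    exact (hbc.measurable.comp h1).sub (hsc.measurable.comp h2)
  have hswap : ∫⁻ ω, ENNReal.ofReal (∫ t in Set.Icc (-r) r, |m ω t|) ∂P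
      = ∫⁻ t in Set.Icc (-r) r, ∫⁻ ω, ENNReal.ofReal |m ω t| ∂P := by
    have hj : Measurable fun p : Ω × ℝ => ENNReal.ofReal |m p.1 p.2| :=
      (continuous_abs.measurable.comp hjoint).ennreal_ofReal
    have hsw := lintegral_lintegral_swap (μ := P) (ν := volume.restrict (Set.Icc (-r) r))
      (f := fun ω t => ENNReal.ofReal |m ω t|) hj.aemeasurable
    rw [← hsw]
    exact lintegral_congr fun ω => ofReal_integral_eq_lintegral_ofReal
      (hmcont ω).abs.integrableOn_Icc (ae_of_all _ fun t => abs_nonneg _)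
  -- The first moment comes from the second through `|x| ≤ s + x² / s`, with `s` left free.
  have hfix : ∀ t, ∫⁻ ω, ENNReal.ofReal |m ω t| ∂P ≤ ENNReal.ofReal (s + s⁻¹ * Q) := by
    intro t
    have hsm : ∀ v, smoothed (fun y => bump h (y - t)) v = smoothed (bump h) (v - t) := fun v => by
      simp only [smoothed, add_sub_right_comm]
    have hsq := lintegral_sq_average_le hm hmt hdep hlip hρ S
      (w := fun y => bump h (y - t)) (by fun_prop) (fun x => abs_bump_le hh _)
      (by positivity : 0 ≤ (h⁻¹) ^ 2)
      (fun x y => (abs_bump_sub_le hh (x - t) (y - t)).trans_eq (by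
        rw [sub_sub_sub_cancel_right]))
    simp_rw [hsm] at hsq
    calc ∫⁻ ω, ENNReal.ofReal |m ω t| ∂P
        ≤ ∫⁻ ω, (ENNReal.ofReal s + ENNReal.ofReal s⁻¹ * ENNReal.ofReal (m ω t ^ 2)) ∂P := by
          refine lintegral_mono fun ω => ?_
          rw [← ENNReal.ofReal_mul (by positivity),
            ← ENNReal.ofReal_add hs.le (by positivity)]
          apply ENNReal.ofReal_le_ofReal
          rw [← sq_abs, inv_mul_eq_div, ← sub_le_iff_le_add', le_div_iff₀ hs]
          nlinarith [sq_nonneg (|m ω t| - s), abs_nonneg (m ω t)]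
      _ = ENNReal.ofReal s + ENNReal.ofReal s⁻¹ * ∫⁻ ω, ENNReal.ofReal (m ω t ^ 2) ∂P := by
          rw [lintegral_add_left measurable_const, lintegral_const, measure_univ, mul_one,
            lintegral_const_mul']
          exact ENNReal.ofReal_ne_top
      _ ≤ ENNReal.ofReal s + ENNReal.ofReal s⁻¹ * ENNReal.ofReal Q := by gcongr
      _ = _ := by
          rw [← ENNReal.ofReal_mul (by positivity),
            ← ENNReal.ofReal_add hs.le (by positivity)]
  rw [hswap]
  refine (lintegral_mono hfix).trans_eq ?_
  rw [lintegral_const, Measure.restrict_apply MeasurableSet.univ, Set.univ_inter,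
    Real.volume_Icc, ← ENNReal.ofReal_mul (by positivity)]
  congr 1
  ring

/-- Given the signal and the other noises, `Z i` has law `N(ν i, 1)`, so the expected mixture mass
of a set is the mean probability that a residual falls in it. This carries the logarithmic tail
hypothesis over to the mixture. -/
lemma lintegral_tail_eq (hm : IsSignalPlusNoise P μ ε) (hmt : ∀ i, Measurable (mt i))
    (hdep : ∀ i, DependsOn (mt i) {j | j ≠ i}) (K : ℝ) :
    ∫⁻ ω, ENNReal.ofReal (∫ z in {z | K < |z|}, mixDensity (centred μ ε mt ω) z) ∂P
      = ENNReal.ofReal ((1 / (n : ℝ)) * ∑ i, P.real {ω | K < |resid μ ε mt ω i|}) := by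
  have hA : MeasurableSet {z : ℝ | K < |z|} := measurableSet_lt measurable_const (by fun_prop)
  have hdens : ∀ v : Fin n → ℝ, ENNReal.ofReal (∫ z in {z | K < |z|}, mixDensity v z)
      = ENNReal.ofReal (n : ℝ)⁻¹ * ∑ i, ∫⁻ x, {z : ℝ | K < |z|}.indicator 1 (v i + x) ∂γ := by
    intro v
    have hcomp : ∀ i, ∫ z in {z | K < |z|}, φ (z - v i)
        = (∫⁻ x, {z : ℝ | K < |z|}.indicator 1 (v i + x) ∂γ).toReal := by
      intro i
      have hpre : MeasurableSet {x : ℝ | K < |v i + x|} :=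
        measurableSet_lt measurable_const (by fun_prop)
      have e1 : ∫⁻ x, {z : ℝ | K < |z|}.indicator 1 (v i + x) ∂γ = γ {x : ℝ | K < |v i + x|} := by
        rw [← lintegral_indicator_one hpre]
        rfl
      rw [e1, ← Measure.real, ← integral_indicator_one hpre, integral_stdGaussian,
        ← integral_indicator hA, ← integral_sub_right_eq_self
          (fun x => φ x * {x : ℝ | K < |v i + x|}.indicator 1 x) (v i)]
      congr 1 with z
      simp only [Set.indicator, Set.mem_ofPred_eq, add_sub_cancel, Pi.one_apply]
      split_ifs <;> simp
    have hle : ∀ i, ∫⁻ x, {z : ℝ | K < |z|}.indicator 1 (v i + x) ∂γ ≠ ∞ := fun i => by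
      refine ne_top_of_le_ne_top (b := 1) ENNReal.one_ne_top ?_
      refine (lintegral_mono (g := fun _ => 1) fun x => ?_).trans_eq (by simp)
      exact Set.indicator_le_self' (fun _ _ => zero_le) _
    unfold mixDensity
    rw [integral_const_mul, integral_finsetSum _ fun i _ =>
      (integrable_stdPDF.comp_sub_right (v i)).integrableOn,
      ENNReal.ofReal_mul (by positivity), ENNReal.ofReal_sum_of_nonneg fun i _ =>
        integral_nonneg fun z => stdPDF_nonneg _]
    simp_rw [hcomp, ENNReal.ofReal_toReal (hle _)]
  have hind : Measurable ({z : ℝ | K < |z|}.indicator (1 : ℝ → ℝ≥0∞)) :=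
    measurable_one.indicator hA
  have hprob : ∀ i, ∫⁻ ω, ∫⁻ x, {z : ℝ | K < |z|}.indicator 1 (centred μ ε mt ω i + x) ∂γ ∂P
      = P {ω | K < |resid μ ε mt ω i|} := by
    intro i
    have hres : MeasurableSet {ω | K < |resid μ ε mt ω i|} :=
      measurableSet_lt measurable_const
        (continuous_abs.measurable.comp ((measurable_pi_apply i).comp (measurable_resid hm hmt)))
    have hVm := measurable_centredOf hmt i
    have hF1 : Measurable fun p : (Fin n → ℝ) × (Fin n → ℝ) =>
        {z : ℝ | K < |z|}.indicator (1 : ℝ → ℝ≥0∞) (centredOf mt p.1 i p.2 + p.2 i) :=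
      hind.comp (hVm.add ((measurable_pi_apply i).comp measurable_snd))
    have hF2 : Measurable fun p : (Fin n → ℝ) × (Fin n → ℝ) =>
        ∫⁻ x, {z : ℝ | K < |z|}.indicator (1 : ℝ → ℝ≥0∞) (centredOf mt p.1 i p.2 + x) ∂γ :=
      Measurable.lintegral_prod_right'
        (f := fun q : ((Fin n → ℝ) × (Fin n → ℝ)) × ℝ =>
          {z : ℝ | K < |z|}.indicator (1 : ℝ → ℝ≥0∞) (centredOf mt q.1.1 i q.1.2 + q.2))
        (hind.comp ((hVm.comp measurable_fst).add measurable_snd))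
    have h1 : P {ω | K < |resid μ ε mt ω i|} = ∫⁻ ω, {z : ℝ | K < |z|}.indicator (1 : ℝ → ℝ≥0∞)
        (centredOf mt (fun i => μ i ω) i (fun i => ε i ω) + ε i ω) ∂P := by
      rw [← lintegral_indicator_one hres]
      refine lintegral_congr fun ω => ?_
      simp only [Set.indicator, Set.mem_ofPred_eq, resid_eq, centred_eq, Pi.one_apply]
    rw [h1, hm.lintegral_eq hF1]
    simp_rw [centred_eq]
    rw [hm.lintegral_eq hF2]
    refine lintegral_congr fun m => ?_
    have hup := lintegral_update γ i (F := fun e => {z : ℝ | K < |z|}.indicator (1 : ℝ → ℝ≥0∞)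
      (centredOf mt m i e + e i)) (hF1.comp (measurable_const.prodMk measurable_id))
    rw [hup]
    refine lintegral_congr fun e => lintegral_congr fun x => ?_
    simp only [centredOf_update_self hdep, Function.update_self]
  simp_rw [hdens]
  rw [lintegral_const_mul' _ _ ENNReal.ofReal_ne_top, lintegral_finsetSum']
  · simp_rw [hprob]
    rw [ENNReal.ofReal_mul (by positivity), one_div,
      ENNReal.ofReal_sum_of_nonneg fun i _ => measureReal_nonneg]
    simp_rw [Measure.real, ENNReal.ofReal_toReal (measure_ne_top _ _)]
  · intro i _
    refine (Measurable.lintegral_prod_right'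
      (f := fun q : Ω × ℝ => {z : ℝ | K < |z|}.indicator (1 : ℝ → ℝ≥0∞)
        (centred μ ε mt q.1 i + q.2)) (hind.comp ?_)).aemeasurable
    exact (((measurable_pi_apply i).comp (measurable_centred hm hmt)).comp measurable_fst).add
      measurable_snd

end Model

/-! ### From the residuals to the mixture -/

lemma truncScore_le_abs {n : ℕ} (hn : 0 < n) (v : Fin n → ℝ) {a η K : ℝ} (z : ℝ) :
    truncScore v a η K z ≤ |mixSlope v z / mixDensity v z + a * z| := by
  have hf := mixDensity_pos v hn z
  have h1 : mixSlope v z / mixDensity v z + a * z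
      = (mixSlope v z + a * z * mixDensity v z) / mixDensity v z := by field_simp
  rw [h1, abs_div, abs_of_pos hf, truncScore]
  calc _ ≤ |mixSlope v z + a * z * mixDensity v z| / mixDensity v z * 1 := by
        gcongr
        · exact cutoff_nonneg _ _
        · exact le_max_left _ _
        · exact cutoff_le_one _ _
    _ = _ := mul_one _

/-- The uniform comparison is applied with the truncated score of `v` itself as test function. Its
average over the `z i` is bounded by the mean square of the untruncated score, through `|x| ≤ s + x²
/ s`. -/
lemma integral_truncScore_le {n : ℕ} (hn : 0 < n) (S : Finset (Fin n)) (v z : Fin n → ℝ)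
    {a η K h s : ℝ} (ha : a ∈ Set.Ioo (0 : ℝ) 1) (hη : 0 < η) (hK : 0 ≤ K) (hh : 0 < h)
    (hs : 0 < s) :
    ∫ t, truncScore v a η K t * mixOn S v t
      ≤ s + s⁻¹ * ((n : ℝ)⁻¹ * ∑ i ∈ S, (mixSlope v (z i) / mixDensity v (z i) + a * z i) ^ 2)
        + 2 * (((2 * K + 5) / η + (K + 2) / η ^ 2) * h)
        + (K + 2) / η * ∫ t in Set.Icc (-(K + 1)) (K + 1),
          |(n : ℝ)⁻¹ * ∑ i ∈ S, (bump h (z i - t) - smoothed (bump h) (v i - t))| := by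
  have hmain := abs_average_sub_integral_le S v z hh (continuous_truncScore v (a := a) (K := K) hη)
    (b := (K + 2) / η) (L := (2 * K + 5) / η + (K + 2) / η ^ 2) (r := K + 1)
    (fun x => by
      rw [abs_of_nonneg (truncScore_nonneg v hη x)]; exact truncScore_le v ha hη hK x)
    (by positivity) (abs_truncScore_sub_le v ha hη hK)
    (fun x hx => by rw [truncScore, cutoff_eq_zero hx.le, mul_zero])
  have havg : (n : ℝ)⁻¹ * ∑ i ∈ S, truncScore v a η K (z i)
      ≤ s + s⁻¹ * ((n : ℝ)⁻¹
        * ∑ i ∈ S, (mixSlope v (z i) / mixDensity v (z i) + a * z i) ^ 2) := by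
    have hpt : ∀ i, truncScore v a η K (z i)
        ≤ s + s⁻¹ * (mixSlope v (z i) / mixDensity v (z i) + a * z i) ^ 2 := fun i => by
      refine (truncScore_le_abs hn v (z i)).trans ?_
      set x := mixSlope v (z i) / mixDensity v (z i) + a * z i
      rw [← sq_abs, inv_mul_eq_div, ← sub_le_iff_le_add', le_div_iff₀ hs]
      nlinarith [sq_nonneg (|x| - s), abs_nonneg x]
    have hcard : |(n : ℝ)⁻¹ * ∑ i ∈ S, s| ≤ s :=
      abs_average_le S hs.le fun i _ => by rw [abs_of_pos hs]
    calc _ ≤ (n : ℝ)⁻¹ * ∑ i ∈ S,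
          (s + s⁻¹ * (mixSlope v (z i) / mixDensity v (z i) + a * z i) ^ 2) := by
          gcongr with i
          exact hpt i
      _ = (n : ℝ)⁻¹ * ∑ i ∈ S, s + s⁻¹ * ((n : ℝ)⁻¹
          * ∑ i ∈ S, (mixSlope v (z i) / mixDensity v (z i) + a * z i) ^ 2) := by
          rw [Finset.sum_add_distrib, ← Finset.mul_sum]; ring
      _ ≤ _ := by
          gcongr
          exact (le_abs_self _).trans hcard
  have := (abs_le.1 hmain).1
  linarith

/-! ### Measurability -/

section Measurability

variable {Ω : Type*} [MeasurableSpace Ω] {n : ℕ} {V : Ω → Fin n → ℝ}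

lemma measurable_mixDensity_prod (hV : Measurable V) :
    Measurable fun p : Ω × ℝ => mixDensity (V p.1) p.2 := by
  have hφ := continuous_stdPDF
  have h : Continuous fun q : (Fin n → ℝ) × ℝ => mixDensity q.1 q.2 := by
    unfold mixDensity
    refine Continuous.mul continuous_const (continuous_finsetSum _ fun i _ => ?_)
    have h1 : Continuous fun q : (Fin n → ℝ) × ℝ => q.2 - q.1 i := by fun_prop
    exact hφ.comp h1
  have hm : Measurable fun p : Ω × ℝ => (V p.1, p.2) := by fun_prop
  have hcomp := h.measurable.comp hm
  simp only [Function.comp_def] at hcomp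
  exact hcomp

lemma measurable_mixSlope_prod (hV : Measurable V) :
    Measurable fun p : Ω × ℝ => mixSlope (V p.1) p.2 := by
  have hφ := continuous_stdPDF
  have h : Continuous fun q : (Fin n → ℝ) × ℝ => mixSlope q.1 q.2 := by
    unfold mixSlope
    refine Continuous.mul continuous_const (continuous_finsetSum _ fun i _ => ?_)
    have h1 : Continuous fun q : (Fin n → ℝ) × ℝ => q.2 - q.1 i := by fun_prop
    exact (h1.mul (hφ.comp h1)).neg
  have hm : Measurable fun p : Ω × ℝ => (V p.1, p.2) := by fun_prop
  have hcomp := h.measurable.comp hm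
  simp only [Function.comp_def] at hcomp
  exact hcomp

lemma measurable_tail (hV : Measurable V) (K : ℝ) :
    Measurable fun ω => ∫ z in {z | K < |z|}, mixDensity (V ω) z :=
  (measurable_mixDensity_prod hV).stronglyMeasurable.integral_prod_right'.measurable

lemma measurable_score_average (hV : Measurable V) {Z : Ω → Fin n → ℝ} (hZ : Measurable Z)
    {a : Ω → ℝ} (ha : Measurable a) (S : Finset (Fin n)) :
    Measurable fun ω => (n : ℝ)⁻¹ * ∑ i ∈ S,
      (mixSlope (V ω) (Z ω i) / mixDensity (V ω) (Z ω i) + a ω * Z ω i) ^ 2 := by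
  refine Measurable.const_mul (Finset.measurable_sum _ fun i _ => Measurable.pow_const ?_ 2) _
  have hZi : Measurable fun ω => Z ω i := (measurable_pi_apply i).comp hZ
  exact (((measurable_mixSlope_prod hV).comp (measurable_id.prodMk hZi)).div
    ((measurable_mixDensity_prod hV).comp (measurable_id.prodMk hZi))).add (ha.mul hZi)

lemma measurable_kernel_discrepancy (hV : Measurable V) {Z : Ω → Fin n → ℝ} (hZ : Measurable Z)
    (S : Finset (Fin n)) {h : ℝ} (hh : 0 < h) (r : ℝ) :
    Measurable fun ω => ∫ t in Set.Icc (-r) r, |(n : ℝ)⁻¹ * ∑ i ∈ S,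
      (bump h (Z ω i - t) - smoothed (bump h) (V ω i - t))| := by
  have hbc := continuous_bump (h := h)
  have hsc := continuous_smoothed hbc (abs_bump_le hh)
  have hj : Measurable fun p : Ω × ℝ => |(n : ℝ)⁻¹ * ∑ i ∈ S,
      (bump h (Z p.1 i - p.2) - smoothed (bump h) (V p.1 i - p.2))| := by
    refine continuous_abs.measurable.comp
      (Measurable.const_mul (Finset.measurable_sum _ fun i _ => ?_) _)
    have h1 : Measurable fun p : Ω × ℝ => Z p.1 i - p.2 :=
      (((measurable_pi_apply i).comp hZ).comp measurable_fst).sub measurable_snd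
    have h2 : Measurable fun p : Ω × ℝ => V p.1 i - p.2 :=
      (((measurable_pi_apply i).comp hV).comp measurable_fst).sub measurable_snd
    exact (hbc.measurable.comp h1).sub (hsc.measurable.comp h2)
  exact hj.stronglyMeasurable.integral_prod_right'.measurable

end Measurability

/-! ### The score of the mixture at the residuals -/

/-- The algebraic link between the two estimators and the differential equation for the mixture
density. -/
lemma score_eq {Ω : Type*} {n : ℕ} {μ ε : Fin n → Ω → ℝ} {mt : Fin n → (Fin n → ℝ) → ℝ}
    (a : ℝ) (ω : Ω) (i : Fin n) :
    mixSlope (centred μ ε mt ω) (resid μ ε mt ω i)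
        / mixDensity (centred μ ε mt ω) (resid μ ε mt ω i) + a * resid μ ε mt ω i
      = improved μ ε mt ω i - (a * mt i (obs μ ε ω) + (1 - a) * obs μ ε ω i) := by
  rw [improved, oracle_eq]
  simp only [resid]
  ring

lemma lintegral_score_average_le {Ω : Type*} [MeasurableSpace Ω] {P : Measure Ω} {n : ℕ}
    (hn : 0 < n) {μ ε : Fin n → Ω → ℝ} (hm : IsSignalPlusNoise P μ ε)
    {mt mh : Fin n → (Fin n → ℝ) → ℝ} (hmt : ∀ i, Measurable (mt i))
    (hmh : ∀ i, Measurable (mh i)) {α : (Fin n → ℝ) → ℝ} (hα : Measurable α)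
    (S : Finset (Fin n)) {B : ℝ≥0∞} (hB : ∀ i ∈ S, ∫⁻ ω, ENNReal.ofReal ((mh i (obs μ ε ω)
      - (α (obs μ ε ω) * mt i (obs μ ε ω) + (1 - α (obs μ ε ω)) * obs μ ε ω i)) ^ 2) ∂P ≤ B) :
    ∫⁻ ω, ENNReal.ofReal ((n : ℝ)⁻¹ * ∑ i ∈ S,
        (mixSlope (centred μ ε mt ω) (resid μ ε mt ω i)
          / mixDensity (centred μ ε mt ω) (resid μ ε mt ω i)
          + α (obs μ ε ω) * resid μ ε mt ω i) ^ 2) ∂P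
      ≤ 2 * ((n : ℝ≥0∞)⁻¹ * ∫⁻ ω, ENNReal.ofReal
          (∑ i, (improved μ ε mt ω i - mh i (obs μ ε ω)) ^ 2) ∂P) + 2 * B := by
  have hobs := measurable_obs hm
  set ζ : Fin n → Ω → ℝ := fun i ω => mh i (obs μ ε ω)
    - (α (obs μ ε ω) * mt i (obs μ ε ω) + (1 - α (obs μ ε ω)) * obs μ ε ω i) with hζ
  have hζm : ∀ i, Measurable (ζ i) := fun i => by
    have h1 := (hmh i).comp hobs
    have h2 := (hmt i).comp hobs
    have h3 := hα.comp hobs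
    have h4 := (measurable_pi_apply i).comp hobs
    exact h1.sub ((h3.mul h2).add ((measurable_const.sub h3).mul h4))
  have hn0 : (n : ℝ≥0∞) ≠ 0 := by exact_mod_cast hn.ne'
  have hninv : ENNReal.ofReal (n : ℝ)⁻¹ = (n : ℝ≥0∞)⁻¹ := by
    rw [ENNReal.ofReal_inv_of_pos (by exact_mod_cast hn), ENNReal.ofReal_natCast]
  have hpt : ∀ ω, ENNReal.ofReal ((n : ℝ)⁻¹ * ∑ i ∈ S,
        (mixSlope (centred μ ε mt ω) (resid μ ε mt ω i)
          / mixDensity (centred μ ε mt ω) (resid μ ε mt ω i)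
          + α (obs μ ε ω) * resid μ ε mt ω i) ^ 2)
      ≤ 2 * ((n : ℝ≥0∞)⁻¹ * ENNReal.ofReal
          (∑ i, (improved μ ε mt ω i - mh i (obs μ ε ω)) ^ 2))
        + 2 * ((n : ℝ≥0∞)⁻¹ * ∑ i ∈ S, ENNReal.ofReal (ζ i ω ^ 2)) := by
    intro ω
    rw [← ENNReal.ofReal_sum_of_nonneg fun i _ => sq_nonneg _, ← hninv,
      ← ENNReal.ofReal_mul (by positivity), ← ENNReal.ofReal_mul (by positivity),
      show (2 : ℝ≥0∞) = ENNReal.ofReal 2 by simp,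
      ← ENNReal.ofReal_mul zero_le_two, ← ENNReal.ofReal_mul zero_le_two,
      ← ENNReal.ofReal_add (by positivity) (by positivity)]
    apply ENNReal.ofReal_le_ofReal
    have h1 : ∑ i ∈ S, (mixSlope (centred μ ε mt ω) (resid μ ε mt ω i)
          / mixDensity (centred μ ε mt ω) (resid μ ε mt ω i)
          + α (obs μ ε ω) * resid μ ε mt ω i) ^ 2
        ≤ 2 * ∑ i, (improved μ ε mt ω i - mh i (obs μ ε ω)) ^ 2 + 2 * ∑ i ∈ S, ζ i ω ^ 2 := by
      calc _ ≤ ∑ i ∈ S, (2 * (improved μ ε mt ω i - mh i (obs μ ε ω)) ^ 2 + 2 * ζ i ω ^ 2) := by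
            refine Finset.sum_le_sum fun i _ => ?_
            rw [score_eq]
            have h2 : improved μ ε mt ω i
                - (α (obs μ ε ω) * mt i (obs μ ε ω) + (1 - α (obs μ ε ω)) * obs μ ε ω i)
                = (improved μ ε mt ω i - mh i (obs μ ε ω)) + ζ i ω := by
              simp only [hζ]; ring
            rw [h2]
            nlinarith [sq_nonneg ((improved μ ε mt ω i - mh i (obs μ ε ω)) - ζ i ω)]
        _ = 2 * ∑ i ∈ S, (improved μ ε mt ω i - mh i (obs μ ε ω)) ^ 2
            + 2 * ∑ i ∈ S, ζ i ω ^ 2 := by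
            rw [Finset.sum_add_distrib, Finset.mul_sum, Finset.mul_sum]
        _ ≤ _ := by
            gcongr
            exact Finset.subset_univ S
    calc _ ≤ (n : ℝ)⁻¹ * (2 * ∑ i, (improved μ ε mt ω i - mh i (obs μ ε ω)) ^ 2
          + 2 * ∑ i ∈ S, ζ i ω ^ 2) := by gcongr
      _ = _ := by ring
  refine (lintegral_mono hpt).trans ?_
  have hζe : ∀ i, Measurable fun ω => ENNReal.ofReal (ζ i ω ^ 2) := fun i =>
    ((hζm i).pow_const 2).ennreal_ofReal
  have hninvtop : (n : ℝ≥0∞)⁻¹ ≠ ∞ := ENNReal.inv_ne_top.2 hn0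
  -- Additivity needs measurability of only one summand, here the remainder.
  rw [lintegral_add_right _ (((Finset.measurable_sum _ fun i _ => hζe i).const_mul _).const_mul _),
    lintegral_const_mul' _ _ (by simp), lintegral_const_mul' _ _ hninvtop,
    lintegral_const_mul' _ _ (by simp), lintegral_const_mul' _ _ hninvtop,
    lintegral_finsetSum _ fun i _ => hζe i]
  gcongr
  calc (n : ℝ≥0∞)⁻¹ * ∑ i ∈ S, ∫⁻ ω, ENNReal.ofReal (ζ i ω ^ 2) ∂P
      ≤ (n : ℝ≥0∞)⁻¹ * (S.card • B) := by
        gcongr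
        exact Finset.sum_le_card_nsmul _ _ _ hB
    _ ≤ (n : ℝ≥0∞)⁻¹ * (n * B) := by
        rw [nsmul_eq_mul]
        gcongr
        exact (Finset.card_le_univ S).trans_eq (Fintype.card_fin n)
    _ = B := by
        rw [← mul_assoc, ENNReal.inv_mul_cancel hn0 (by simp), one_mul]

/-! ### Rates -/

lemma tendsto_log_natCast : Tendsto (fun n : ℕ => Real.log n) atTop atTop :=
  Real.tendsto_log_atTop.comp tendsto_natCast_atTop_atTop

lemma tendsto_log_pow_div (k : ℕ) :
    Tendsto (fun n : ℕ => (Real.log n) ^ k / (n : ℝ)) atTop (𝓝 0) :=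
  (Real.isLittleO_pow_log_id_atTop (n := k)).tendsto_div_nhds_zero.comp
    tendsto_natCast_atTop_atTop

/-- Mollification error with `η = K⁻⁴` and `h = K⁻¹⁰`: the Lipschitz constant is of order `K / η² =
K⁹`, just beaten by `h`. -/
lemma lipschitz_rate_le {K : ℝ} (hK : 1 ≤ K) :
    2 * (((2 * K + 5) / (K ^ 4)⁻¹ + (K + 2) / ((K ^ 4)⁻¹) ^ 2) * (K ^ 10)⁻¹) ≤ 20 * K⁻¹ := by
  have hK0 : 0 < K := zero_lt_one.trans_le hK
  have h1 : 2 * (((2 * K + 5) / (K ^ 4)⁻¹ + (K + 2) / ((K ^ 4)⁻¹) ^ 2) * (K ^ 10)⁻¹)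
      = 2 * ((2 * K + 5) * K ^ 4 + (K + 2) * K ^ 8) / K ^ 10 := by field_simp
  rw [h1, div_le_iff₀ (by positivity)]
  have h2 : 20 * K⁻¹ * K ^ 10 = 20 * K ^ 9 := by field_simp
  rw [h2]
  have h3 : K ^ 4 ≤ K ^ 8 := pow_le_pow_right₀ hK (by norm_num)
  calc 2 * ((2 * K + 5) * K ^ 4 + (K + 2) * K ^ 8)
      ≤ 2 * ((2 * K + 5 * K) * K ^ 8 + (K + 2 * K) * K ^ 8) := by
        gcongr <;> linarith
    _ = 20 * K ^ 9 := by ring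

/-- The score bound and the interval length give `K⁶`. The choice `s = K⁻¹⁰` leaves `K⁻⁴`, while the
variance contributes `K⁶ * s⁻¹ * h⁻³ / n = K⁴⁶ / n`. -/
lemma kernel_rate_le {K T : ℝ} (hK : 1 ≤ K) (hT : 0 ≤ T) (n : ℕ) :
    (K + 2) / (K ^ 4)⁻¹ * (2 * (K + 1) * ((K ^ 10)⁻¹ + ((K ^ 10)⁻¹)⁻¹ *
      ((4 * (((K ^ 10)⁻¹)⁻¹) ^ 2 + 4 * ((K ^ 10)⁻¹)⁻¹ * (((K ^ 10)⁻¹)⁻¹) ^ 2 * (2 * T)) / n)))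
      ≤ 12 * (K ^ 4)⁻¹ + 12 * (4 + 8 * T) * (K ^ 46 / n) := by
  have hK0 : 0 < K := zero_lt_one.trans_le hK
  simp only [inv_inv, div_inv_eq_mul]
  have h1 : 4 * (K ^ 10) ^ 2 + 4 * K ^ 10 * (K ^ 10) ^ 2 * (2 * T) ≤ (4 + 8 * T) * K ^ 30 := by
    have h2 : K ^ 20 ≤ K ^ 30 := pow_le_pow_right₀ hK (by norm_num)
    calc _ = 4 * K ^ 20 + 8 * T * K ^ 30 := by ring
      _ ≤ 4 * K ^ 30 + 8 * T * K ^ 30 := by gcongr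
      _ = _ := by ring
  calc _ ≤ (K + 2 * K) * K ^ 4 * (2 * (K + K) * ((K ^ 10)⁻¹
        + K ^ 10 * ((4 + 8 * T) * K ^ 30 / n))) := by
        gcongr
        linarith
    _ = _ := by
        field_simp
        ring

/-! ### Convergence in probability -/

lemma measure_ofReal_ge_le {Ω : Type*} [MeasurableSpace Ω] {P : Measure Ω} {X : Ω → ℝ}
    (hX : Measurable X) {c : ℝ} (hc : 0 < c) :
    P {ω | c ≤ X ω} ≤ (∫⁻ ω, ENNReal.ofReal (X ω) ∂P) / ENNReal.ofReal c := by
  refine (measure_mono fun ω hω => ?_).trans (meas_ge_le_lintegral_div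
    hX.ennreal_ofReal.aemeasurable (ENNReal.ofReal_pos.2 hc).ne' ENNReal.ofReal_ne_top)
  exact ENNReal.ofReal_le_ofReal hω

lemma tendsto_div_ofReal {u : ℕ → ℝ≥0∞} (hu : Tendsto u atTop (𝓝 0)) {c : ℝ} (hc : 0 < c) :
    Tendsto (fun n => u n / ENNReal.ofReal c) atTop (𝓝 0) := by
  have := ENNReal.Tendsto.div_const hu (Or.inr (ENNReal.ofReal_pos.2 hc).ne')
  simpa using this

lemma exists_abs_le_of_tendsto_cocompact {g : ℝ → ℝ} (hg : Continuous g)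
    (h0 : Tendsto g (cocompact ℝ) (𝓝 0)) : ∃ C : ℝ, ∀ x, |g x| ≤ C := by
  let f : ZeroAtInftyContinuousMap ℝ ℝ := ⟨⟨g, hg⟩, h0⟩
  exact ⟨‖f.toBCF‖, fun x => f.toBCF.norm_coe_le_norm x⟩

/-! ### Markov bounds and the union bound for the discrepancy -/

section Main

variable {Ω : ℕ → Type*} [∀ n, MeasurableSpace (Ω n)] {P : ∀ n, Measure (Ω n)}
  {μ ε : ∀ n, Fin n → Ω n → ℝ}
  {mt mh : ∀ n, Fin n → (Fin n → ℝ) → ℝ} {ρ : ℕ → ℝ} {α : ∀ n, (Fin n → ℝ) → ℝ}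

lemma tendsto_lintegral_score (hmodel : ∀ n, IsSignalPlusNoise (P n) (μ n) (ε n))
    (hmh : ∀ n i, Measurable (mh n i)) (h1 : IsLocalPredictor mt ρ)
    (h2 : IsAsymptoticAverage P μ ε mt mh α)
    (hequiv : Tendsto (fun n : ℕ => (n : ℝ≥0∞)⁻¹ *
        ∫⁻ ω, ENNReal.ofReal (∑ i, (improved (μ n) (ε n) (mt n) ω i
          - mh n i (obs (μ n) (ε n) ω)) ^ 2) ∂P n) atTop (𝓝 0)) {c : ℝ} (hc : 0 < c) :
    Tendsto (fun n : ℕ => ∫⁻ ω, ENNReal.ofReal ((n : ℝ)⁻¹ * ∑ i ∈ middle c n,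
        (mixSlope (centred (μ n) (ε n) (mt n) ω) (resid (μ n) (ε n) (mt n) ω i)
          / mixDensity (centred (μ n) (ε n) (mt n) ω) (resid (μ n) (ε n) (mt n) ω i)
          + α n (obs (μ n) (ε n) ω) * resid (μ n) (ε n) (mt n) ω i) ^ 2) ∂P n)
      atTop (𝓝 0) := by
  have hlim := (ENNReal.Tendsto.const_mul (a := 2) hequiv (Or.inr (by simp))).add
    (ENNReal.Tendsto.const_mul (a := 2) (h2.remainder c hc) (Or.inr (by simp)))
  rw [mul_zero, add_zero] at hlim
  refine tendsto_of_tendsto_of_tendsto_of_le_of_le' tendsto_const_nhds hlim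
    (Eventually.of_forall fun n => zero_le) ?_
  filter_upwards [eventually_gt_atTop 0] with n hn
  exact lintegral_score_average_le hn (hmodel n) (h1.measurable n) (hmh n) (h2.measurable n) _
    fun i hi => le_iSup₂_of_le i (mem_middle.1 hi) le_rfl

variable [∀ n, IsProbabilityMeasure (P n)]

lemma tendsto_lintegral_tail (hmodel : ∀ n, IsSignalPlusNoise (P n) (μ n) (ε n))
    (h1 : IsLocalPredictor mt ρ) (h3 : HasLogTails P μ ε mt) :
    Tendsto (fun n : ℕ => ∫⁻ ω, ENNReal.ofReal (∫ z in {z | Real.log n < |z|},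
      mixDensity (centred (μ n) (ε n) (mt n) ω) z) ∂P n) atTop (𝓝 0) := by
  have hlim : Tendsto (fun n : ℕ => ENNReal.ofReal (1 / (Real.log n) ^ 8)) atTop (𝓝 0) := by
    rw [← ENNReal.ofReal_zero]
    refine ENNReal.tendsto_ofReal ?_
    simp only [one_div]
    exact tendsto_inv_atTop_zero.comp
      ((tendsto_pow_atTop (by norm_num)).comp tendsto_log_natCast)
  refine tendsto_of_tendsto_of_tendsto_of_le_of_le' tendsto_const_nhds hlim
    (Eventually.of_forall fun n => zero_le) ?_
  filter_upwards [h3] with n hn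
  rw [lintegral_tail_eq (hmodel n) (h1.measurable n) (h1.dependsOn n)]
  exact ENNReal.ofReal_le_ofReal hn

lemma tendsto_lintegral_kernel (hmodel : ∀ n, IsSignalPlusNoise (P n) (μ n) (ε n))
    (h1 : IsLocalPredictor mt ρ) (S : ∀ n, Finset (Fin n)) :
    Tendsto (fun n : ℕ => ∫⁻ ω, ENNReal.ofReal ((Real.log n + 2) / ((Real.log n) ^ 4)⁻¹ *
      ∫ t in Set.Icc (-(Real.log n + 1)) (Real.log n + 1), |(n : ℝ)⁻¹ * ∑ i ∈ S n,
        (bump ((Real.log n) ^ 10)⁻¹ (resid (μ n) (ε n) (mt n) ω i - t)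
          - smoothed (bump ((Real.log n) ^ 10)⁻¹) (centred (μ n) (ε n) (mt n) ω i - t))|) ∂P n)
      atTop (𝓝 0) := by
  set T : ℝ := ∑' M, max (ρ M) 0 with hTdef
  have hT : 0 ≤ T := tsum_nonneg fun M => le_max_right _ _
  have hlim : Tendsto (fun n : ℕ => ENNReal.ofReal (12 * ((Real.log n) ^ 4)⁻¹
      + 12 * (4 + 8 * T) * ((Real.log n) ^ 46 / n))) atTop (𝓝 0) := by
    rw [← ENNReal.ofReal_zero]
    refine ENNReal.tendsto_ofReal ?_
    have e1 := tendsto_inv_atTop_zero.comp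
      ((tendsto_pow_atTop (α := ℝ) (n := 4) (by norm_num)).comp tendsto_log_natCast)
    simpa using (e1.const_mul 12).add ((tendsto_log_pow_div 46).const_mul (12 * (4 + 8 * T)))
  refine tendsto_of_tendsto_of_tendsto_of_le_of_le' tendsto_const_nhds hlim
    (Eventually.of_forall fun n => zero_le) ?_
  filter_upwards [tendsto_log_natCast.eventually_ge_atTop 1] with n hK
  have hK0 : 0 < Real.log n := zero_lt_one.trans_le hK
  have hb : 0 ≤ (Real.log n + 2) / ((Real.log n) ^ 4)⁻¹ := by positivity
  simp_rw [ENNReal.ofReal_mul hb]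
  rw [lintegral_const_mul' _ _ ENNReal.ofReal_ne_top]
  refine (mul_le_mul_right (lintegral_kernel_discrepancy_le (hmodel n) (h1.measurable n)
    (h1.dependsOn n) (h1.lipschitz n) h1.summable_posPart (S n)
    (h := ((Real.log n) ^ 10)⁻¹) (r := Real.log n + 1) (s := ((Real.log n) ^ 10)⁻¹)
    (by positivity) (by positivity)) _).trans ?_
  rw [← ENNReal.ofReal_mul hb]
  exact ENNReal.ofReal_le_ofReal (kernel_rate_le hK hT n)

/-- Up to a vanishing error, the discrepancy can exceed `e` only where `α` is below `A`. -/
lemma exists_prob_discrepancy_le (hmodel : ∀ n, IsSignalPlusNoise (P n) (μ n) (ε n))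
    (hmh : ∀ n i, Measurable (mh n i)) (h1 : IsLocalPredictor mt ρ)
    (h2 : IsAsymptoticAverage P μ ε mt mh α) (h3 : HasLogTails P μ ε mt)
    (hequiv : Tendsto (fun n : ℕ => (n : ℝ≥0∞)⁻¹ *
        ∫⁻ ω, ENNReal.ofReal (∑ i, (improved (μ n) (ε n) (mt n) ω i
          - mh n i (obs (μ n) (ε n) ω)) ^ 2) ∂P n) atTop (𝓝 0))
    {g : ℝ → ℝ} (hg : Continuous g) {C : ℝ} (hC : ∀ x, |g x| ≤ C) {A : ℝ}
    (hA : 0 < A ∨ Tendsto g (cocompact ℝ) (𝓝 0)) {e : ℝ} (he : 0 < e) :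
    ∃ u : ℕ → ℝ≥0∞, Tendsto u atTop (𝓝 0) ∧ ∀ᶠ n : ℕ in atTop,
      P n {ω | e ≤ |discrepancy (μ n) (ε n) (mt n) (α n) g ω|}
        ≤ P n {ω | α n (obs (μ n) (ε n) ω) < A} + u n := by
  obtain ⟨δ, hδ, hev⟩ := exists_abs_gap_lt hg hC hA he
  have t1 := tendsto_div_ofReal (tendsto_lintegral_tail hmodel h1 h3) hδ
  -- The bound on the score integral has four terms, each to be at most `δ / 4`. With `s = δ / 4`,
  -- the mean square enters divided by `s`, hence the threshold `δ² / 16`.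
  have t2 := tendsto_div_ofReal (tendsto_lintegral_score hmodel hmh h1 h2 hequiv hδ)
    (by positivity : 0 < δ ^ 2 / 16)
  have t3 := tendsto_div_ofReal (tendsto_lintegral_kernel hmodel h1 (middle δ))
    (by positivity : 0 < δ / 4)
  have t := (t1.add t2).add t3
  rw [add_zero, add_zero] at t
  refine ⟨_, t, ?_⟩
  have hrate : ∀ᶠ n : ℕ in atTop, 20 * (Real.log n)⁻¹ ≤ δ / 4 := by
    have := (tendsto_inv_atTop_zero.comp tendsto_log_natCast).const_mul 20
    rw [mul_zero] at this
    filter_upwards [this.eventually (gt_mem_nhds (by positivity : 0 < δ / 4))] with n hn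
    exact hn.le
  filter_upwards [hev, hrate, eventually_gt_atTop 0,
    tendsto_log_natCast.eventually_ge_atTop 1] with n hgap hrate hn hK
  have hK0 : 0 < Real.log n := zero_lt_one.trans_le hK
  have hobs := measurable_obs (hmodel n)
  have hcen := measurable_centred (hmodel n) (h1.measurable n)
  have hres := measurable_resid (hmodel n) (h1.measurable n)
  have m1 := measure_ofReal_ge_le (P := P n) (measurable_tail hcen (Real.log n)) hδ
  have m2 := measure_ofReal_ge_le (P := P n) (measurable_score_average hcen hres
    ((h2.measurable n).comp hobs) (middle δ n)) (by positivity : 0 < δ ^ 2 / 16)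
  have m3 := measure_ofReal_ge_le (P := P n) ((measurable_kernel_discrepancy hcen hres
    (middle δ n) (by positivity : 0 < ((Real.log n) ^ 10)⁻¹) (Real.log n + 1)).const_mul
      ((Real.log n + 2) / ((Real.log n) ^ 4)⁻¹)) (by positivity : 0 < δ / 4)
  have hnull : P n {ω | ¬ α n (obs (μ n) (ε n) ω) ∈ Set.Ioo (0 : ℝ) 1} = 0 :=
    ae_iff.1 (h2.mem_Ioo n)
  -- Outside `α < A`, the null set where `α ∉ (0, 1)` and the three Markov events, the deterministic
  -- statement applies at `ω`. Monotonicity of the measure asks for no measurability of the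
  -- discrepancy.
  refine le_trans (measure_mono ?_) ((measure_union_le _ _).trans (add_le_add
    ((measure_union_le {ω | α n (obs (μ n) (ε n) ω) < A}
      {ω | ¬ α n (obs (μ n) (ε n) ω) ∈ Set.Ioo (0 : ℝ) 1}).trans_eq
      (by rw [hnull, add_zero]))
    ((measure_union_le _ _).trans (add_le_add ((measure_union_le _ _).trans
      (add_le_add m1 m2)) m3))))
  intro ω hω
  by_contra hcon
  simp only [Set.mem_union, Set.mem_ofPred_eq, not_or, not_not, not_le, not_lt,
    Function.comp] at hcon
  obtain ⟨⟨hAα, hα⟩, ⟨hb1, hb2⟩, hb3⟩ := hcon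
  have hlt := hgap (centred (μ n) (ε n) (mt n) ω) _ hα hAα ?_ hb1.le
  · exact absurd hω (not_le.2 hlt)
  · refine (integral_truncScore_le hn (middle δ n) (centred (μ n) (ε n) (mt n) ω)
      (resid (μ n) (ε n) (mt n) ω) hα (by positivity : 0 < ((Real.log n) ^ 4)⁻¹) hK0.le
      (by positivity : 0 < ((Real.log n) ^ 10)⁻¹) (by positivity : 0 < δ / 4)).trans ?_
    have hl := (lipschitz_rate_le hK).trans hrate
    have hs := mul_le_mul_of_nonneg_left hb2.le (by positivity : 0 ≤ (δ / 4)⁻¹)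
    have hs' : (δ / 4)⁻¹ * (δ ^ 2 / 16) = δ / 4 := by field_simp; norm_num
    linarith

/-- The level `A` is chosen after the tolerance, so that `Y n < A` has probability at most half of
it; the vanishing error takes the other half. -/
lemma tendstoZeroInProb_of_bound {X : ∀ n, Ω n → ℝ} {Y : ∀ n, Ω n → ℝ}
    (h : ∀ e A : ℝ, 0 < e → 0 < A → ∃ u : ℕ → ℝ≥0∞, Tendsto u atTop (𝓝 0) ∧
      ∀ᶠ n : ℕ in atTop, P n {ω | e ≤ |X n ω|} ≤ P n {ω | Y n ω < A} + u n)
    (hY : BoundedBelowInProb P Y) : TendstoZeroInProb P X := by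
  intro e he
  rw [ENNReal.tendsto_nhds_zero]
  intro d hd
  obtain ⟨r, hr0, hrd⟩ := ENNReal.lt_iff_exists_real_btwn.1 hd
  have hrpos : 0 < r := ENNReal.ofReal_pos.1 hrd.1
  obtain ⟨c, hc, hcev⟩ := hY (r / 2) (half_pos hrpos)
  obtain ⟨u, hu, hev⟩ := h e c he hc
  filter_upwards [hcev, hev, ENNReal.tendsto_nhds_zero.1 hu (ENNReal.ofReal (r / 2))
    (ENNReal.ofReal_pos.2 (half_pos hrpos))] with n hn1 hn2 hn3
  have hn4 : P n {ω | Y n ω < c} ≤ ENNReal.ofReal (r / 2) := by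
    rw [← ENNReal.ofReal_toReal (measure_ne_top (P n) {ω | Y n ω < c})]
    exact ENNReal.ofReal_le_ofReal hn1
  calc _ ≤ _ := hn2
    _ ≤ ENNReal.ofReal (r / 2) + ENNReal.ofReal (r / 2) := add_le_add hn4 hn3
    _ = ENNReal.ofReal r := by
      rw [← ENNReal.ofReal_add (by positivity) (by positivity), add_halves]
    _ ≤ d := hrd.2.le

end Main

end KalmanEB

theorem proposition1 {Ω : ℕ → Type*} [∀ n, MeasurableSpace (Ω n)]
    (P : ∀ n, Measure (Ω n)) [∀ n, IsProbabilityMeasure (P n)]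
    (μ ε : ∀ n, Fin n → Ω n → ℝ)
    (hmodel : ∀ n, KalmanEB.IsSignalPlusNoise (P n) (μ n) (ε n))
    (mt mh : ∀ n, Fin n → (Fin n → ℝ) → ℝ)
    (hmh : ∀ n i, Measurable (mh n i))
    (ρ : ℕ → ℝ) (h1 : KalmanEB.IsLocalPredictor mt ρ)
    (α : ∀ n, (Fin n → ℝ) → ℝ)
    (h2 : KalmanEB.IsAsymptoticAverage P μ ε mt mh α)
    (h3 : KalmanEB.HasLogTails P μ ε mt)
    (hequiv : Tendsto (fun n : ℕ => (n : ℝ≥0∞)⁻¹ *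
        ∫⁻ ω, ENNReal.ofReal (∑ i, (KalmanEB.improved (μ n) (ε n) (mt n) ω i
          - mh n i (KalmanEB.obs (μ n) (ε n) ω)) ^ 2) ∂P n) atTop (𝓝 0)) :
    (KalmanEB.BoundedBelowInProb P (fun n ω => α n (KalmanEB.obs (μ n) (ε n) ω)) →
      ∀ g : ℝ → ℝ, Continuous g → (∃ C : ℝ, ∀ x, |g x| ≤ C) →
        KalmanEB.TendstoZeroInProb P
          (fun n => KalmanEB.discrepancy (μ n) (ε n) (mt n) (α n) g)) ∧
    (∀ g : ℝ → ℝ, Continuous g → Tendsto g (cocompact ℝ) (𝓝 0) →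
        KalmanEB.TendstoZeroInProb P
          (fun n => KalmanEB.discrepancy (μ n) (ε n) (mt n) (α n) g)) := by
  refine ⟨fun hbelow g hg ⟨C, hC⟩ => ?_, fun g hg h0 => ?_⟩
  · exact KalmanEB.tendstoZeroInProb_of_bound (fun e A he hA =>
      KalmanEB.exists_prob_discrepancy_le hmodel hmh h1 h2 h3 hequiv hg hC (Or.inl hA) he) hbelow
  · obtain ⟨C, hC⟩ := KalmanEB.exists_abs_le_of_tendsto_cocompact hg h0
    intro e he
    -- With `g` vanishing at infinity no lower bound on `α` is needed: at level `A = 0` the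
    -- exceptional event `α < 0` is null.
    obtain ⟨u, hu, hev⟩ := KalmanEB.exists_prob_discrepancy_le hmodel hmh h1 h2 h3 hequiv hg hC
      (A := 0) (Or.inr h0) he
    refine tendsto_of_tendsto_of_tendsto_of_le_of_le' tendsto_const_nhds hu
      (Eventually.of_forall fun n => zero_le) ?_
    filter_upwards [hev] with n hn
    have hnull : P n {ω | α n (KalmanEB.obs (μ n) (ε n) ω) < 0} = 0 := by
      refine measure_mono_null (fun ω hω => ?_) (ae_iff.1 (h2.mem_Ioo n))
      exact fun hmem => lt_asymm hω hmem.1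
    rwa [hnull, zero_add] at hn
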